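/- Points in the plane are measured by the $L_1$-metric. An axis-aligned highway cross of speed $v>1$ is the union of a vertical and a horizontal line (two highways); one travels with speed $v$ along the highways and with speed $1$ elsewhere, entering and leaving the highways anywhere, and the travel-time distance of two points is the infimum of the travel times of all paths between them. The travel-time diameter of a finite set $S\subset\mathbb{R}^2$ with respect to a cross is the maximum travel-time distance between two points of $S$; a cross is optimal for $S$ if it minimizes this diameter among all axis-aligned crosses of speed $v$, and $\delta_{\mathrm{opt}}(S)$ denotes the minimum. An enclosing cross for $S$ is the union of a horizontal and a vertical strip of equal width that contains $S$; the median highways are the middle lines of the two strips of a smallest enclosing cross (one of minimum width). Theorem. (1) Let $v>1$ and let $S\subset\mathbb{R}^2$ be finite and non-empty. A smallest enclosing cross and an optimal highway cross for $S$ exist; for every smallest enclosing cross the median highways with speed $v$ have travel-time diameter at most $(2+1/v)\,\delta_{\mathrm{opt}}(S)$; and the travel-time diameter of $S$ without any highway (its $L_1$-diameter) is at most $v\,\delta_{\mathrm{opt}}(S)$. (2) For every $v\ge\sqrt3$ there is a finite set $S\subset\mathbb{R}^2$ of at least three points such that, for every smallest enclosing cross of $S$, the median highways with speed $v$ have travel-time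 diameter at least $\bigl(2-\frac1{v+2}\bigr)\,\delta_{\mathrm{opt}}(S)$. (3) There are a program for the real RAM (unit cost per arithmetic operation or comparison of reals, per index addition, subtraction or comparison, and per array access) and a constant $C$ such that for every $v>1$, every $n\ge2$ and every sequence $S$ of $n$ points in the plane, the program on input $(n,v,S)$ halts after at most $C\,n\log n$ steps and outputs the centre of an axis-aligned highway cross whose travel-time diameter with speed $v$ is at most $(1+\sqrt2)\,\delta_{\mathrm{opt}}(S)$. -/

import Mathlib

/-! ### Travel times in the plane with an axis-aligned highway cross

Points of the plane are pairs of reals and distances are `L₁`-distances.  A highway cross is given by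
its centre `σ`: it consists of the vertical line `x = σ.1` and the horizontal line `y = σ.2`. -/

/-- The `L₁`-distance. -/
def l1Dist (a b : ℝ × ℝ) : ℝ := |a.1 - b.1| + |a.2 - b.2|

/-- `a` and `b` lie on a common highway of the cross centred at `σ`. -/
def OnCommonHighway (σ a b : ℝ × ℝ) : Prop :=
  (a.1 = σ.1 ∧ b.1 = σ.1) ∨ (a.2 = σ.2 ∧ b.2 = σ.2)

open Classical in
/-- Time needed for one leg from `a` to `b`: speed `v` if the leg runs along a highway, speed `1`
otherwise. -/
noncomputable def legTime (v : ℝ) (σ a b : ℝ × ℝ) : ℝ :=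
  if OnCommonHighway σ a b then l1Dist a b / v else l1Dist a b

/-- Time needed to travel from `p` to `q` through the waypoints in the list, in order. -/
noncomputable def pathTime (v : ℝ) (σ : ℝ × ℝ) : ℝ × ℝ → List (ℝ × ℝ) → ℝ × ℝ → ℝ
  | p, [], q => legTime v σ p q
  | p, a :: l, q => legTime v σ p a + pathTime v σ a l q

/-- Travel-time distance: the infimum of the travel times of all paths from `p` to `q`. -/
noncomputable def travelTime (v : ℝ) (σ p q : ℝ × ℝ) : ℝ :=
  ⨅ l : List (ℝ × ℝ), pathTime v σ p l q

/-- Travel-time diameter of `S` for the speed-`v` highway cross centred at `σ`. -/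
noncomputable def travelDiam (v : ℝ) (S : Set (ℝ × ℝ)) (σ : ℝ × ℝ) : ℝ :=
  sSup {t | ∃ p ∈ S, ∃ q ∈ S, t = travelTime v σ p q}

/-- Travel-time diameter of `S` without any highway, i.e. the `L₁`-diameter. -/
noncomputable def l1Diam (S : Set (ℝ × ℝ)) : ℝ :=
  sSup {t | ∃ p ∈ S, ∃ q ∈ S, t = l1Dist p q}

/-- The speed-`v` cross centred at `τ` is an optimal axis-aligned highway cross for `S`. -/
def IsOptimalCross (v : ℝ) (S : Set (ℝ × ℝ)) (τ : ℝ × ℝ) : Prop :=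
  ∀ σ : ℝ × ℝ, travelDiam v S τ ≤ travelDiam v S σ

/-- The union of the vertical and the horizontal strip of width `w` whose middle lines are
`x = c.1` and `y = c.2`. -/
def stripCross (c : ℝ × ℝ) (w : ℝ) : Set (ℝ × ℝ) :=
  {z | |z.1 - c.1| ≤ w / 2} ∪ {z | |z.2 - c.2| ≤ w / 2}

/-- The strip cross with middle lines through `c` and width `w` is a smallest enclosing cross
for `S`. -/
def IsSmallestEnclosingCross (S : Set (ℝ × ℝ)) (c : ℝ × ℝ) (w : ℝ) : Prop :=
  0 ≤ w ∧ S ⊆ stripCross c w ∧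
    ∀ (c' : ℝ × ℝ) (w' : ℝ), 0 ≤ w' → S ⊆ stripCross c' w' → w ≤ w'

/-- The highway cross centred at `c` consists of median highways for `S`: the middle lines of a
smallest enclosing cross. -/
def IsMedianCross (S : Set (ℝ × ℝ)) (c : ℝ × ℝ) : Prop :=
  ∃ w : ℝ, IsSmallestEnclosingCross S c w

/-! ### A real RAM

Finite structured programs over finitely many index registers, real registers, and index and real
arrays (addressed by index registers).  Each elementary instruction and each test takes one step.
Index arithmetic is addition and truncated subtraction; there is no conversion between reals and
indices, and no rounding. -/

namespace RealRAM

/-- The memory: registers are numbered, arrays are numbered and indexed by natural numbers. -/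
structure State where
  /-- index registers -/
  idx : ℕ → ℕ
  /-- real registers -/
  reg : ℕ → ℝ
  /-- index arrays: array number, position -/
  iarr : ℕ → ℕ → ℕ
  /-- real arrays: array number, position -/
  rarr : ℕ → ℕ → ℝ

inductive RealOp where
  | add | sub | mul | div

/-- Division by zero returns zero. -/
noncomputable def RealOp.eval : RealOp → ℝ → ℝ → ℝ
  | .add, x, y => x + y
  | .sub, x, y => x - y
  | .mul, x, y => x * y
  | .div, x, y => x / y

/-- Comparisons of two registers. -/
inductive Test where
  /-- index register `i` < index register `j` -/
  | idxLt (i j : ℕ)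
  /-- real register `x` < real register `y` -/
  | realLt (x y : ℕ)

def Test.Holds : Test → State → Prop
  | .idxLt i j, s => s.idx i < s.idx j
  | .realLt x y, s => s.reg x < s.reg y

/-- Elementary instructions; all arguments are register numbers or array numbers, except for the
literal constants. -/
inductive Instr where
  /-- `idx i := k` -/
  | idxConst (i k : ℕ)
  /-- `idx i := idx j + idx k` -/
  | idxAdd (i j k : ℕ)
  /-- `idx i := idx j - idx k` (truncated) -/
  | idxSub (i j k : ℕ)
  /-- `idx i := iarr a [idx j]` -/
  | idxLoad (i a j : ℕ)
  /-- `iarr a [idx j] := idx i` -/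
  | idxStore (a j i : ℕ)
  /-- `reg x := q` -/
  | realConst (x : ℕ) (q : ℚ)
  /-- `reg x := reg y ∘ reg z` -/
  | realOp (o : RealOp) (x y z : ℕ)
  /-- `reg x := rarr a [idx j]` -/
  | realLoad (x a j : ℕ)
  /-- `rarr a [idx j] := reg x` -/
  | realStore (a j x : ℕ)

/-- Effect of an elementary instruction on the memory. -/
noncomputable def Instr.eval : Instr → State → State
  | .idxConst i k, s => { s with idx := Function.update s.idx i k }
  | .idxAdd i j k, s => { s with idx := Function.update s.idx i (s.idx j + s.idx k) }
  | .idxSub i j k, s => { s with idx := Function.update s.idx i (s.idx j - s.idx k) }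
  | .idxLoad i a j, s => { s with idx := Function.update s.idx i (s.iarr a (s.idx j)) }
  | .idxStore a j i, s =>
      { s with iarr := Function.update s.iarr a (Function.update (s.iarr a) (s.idx j) (s.idx i)) }
  | .realConst x q, s => { s with reg := Function.update s.reg x (q : ℝ) }
  | .realOp o x y z, s => { s with reg := Function.update s.reg x (o.eval (s.reg y) (s.reg z)) }
  | .realLoad x a j, s => { s with reg := Function.update s.reg x (s.rarr a (s.idx j)) }
  | .realStore a j x, s =>
      { s with rarr := Function.update s.rarr a (Function.update (s.rarr a) (s.idx j) (s.reg x)) }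

/-- Programs. -/
inductive Program where
  | skip
  | instr (c : Instr)
  | seq (P Q : Program)
  | cond (b : Test) (P Q : Program)
  | loop (b : Test) (P : Program)

/-- `Exec P s s' t`: started in memory `s`, the program `P` halts in memory `s'` after exactly `t`
steps. -/
inductive Exec : Program → State → State → ℕ → Prop where
  | skip (s : State) : Exec .skip s s 1
  | instr (c : Instr) (s : State) : Exec (.instr c) s (c.eval s) 1
  | seq {P Q : Program} {s s' s'' : State} {t t' : ℕ} :
      Exec P s s' t → Exec Q s' s'' t' → Exec (.seq P Q) s s'' (t + t')
  | condTrue {b : Test} {P Q : Program} {s s' : State} {t : ℕ} :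
      b.Holds s → Exec P s s' t → Exec (.cond b P Q) s s' (t + 1)
  | condFalse {b : Test} {P Q : Program} {s s' : State} {t : ℕ} :
      ¬ b.Holds s → Exec Q s s' t → Exec (.cond b P Q) s s' (t + 1)
  | loopTrue {b : Test} {P : Program} {s s' s'' : State} {t t' : ℕ} :
      b.Holds s → Exec P s s' t → Exec (.loop b P) s' s'' t' →
        Exec (.loop b P) s s'' (t + t' + 1)
  | loopFalse {b : Test} {P : Program} {s : State} :
      ¬ b.Holds s → Exec (.loop b P) s s 1

/-- The machine is deterministic: final memory and number of steps are determined by program and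
initial memory. -/
theorem Exec.det {P : Program} {s s₁ : State} {t₁ : ℕ} (h₁ : Exec P s s₁ t₁) :
    ∀ {s₂ : State} {t₂ : ℕ}, Exec P s s₂ t₂ → s₁ = s₂ ∧ t₁ = t₂ := by
  induction h₁ with
  | skip s => intro s₂ t₂ h; cases h; exact ⟨rfl, rfl⟩
  | instr c s => intro s₂ t₂ h; cases h; exact ⟨rfl, rfl⟩
  | seq _ _ ih ih' =>
    intro s₂ t₂ h
    cases h with
    | seq h h' =>
      obtain ⟨rfl, rfl⟩ := ih h
      obtain ⟨rfl, rfl⟩ := ih' h'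
      exact ⟨rfl, rfl⟩
  | condTrue hb _ ih =>
    intro s₂ t₂ h
    cases h with
    | condTrue _ h => obtain ⟨rfl, rfl⟩ := ih h; exact ⟨rfl, rfl⟩
    | condFalse hn _ => exact absurd hb hn
  | condFalse hb _ ih =>
    intro s₂ t₂ h
    cases h with
    | condTrue hn _ => exact absurd hn hb
    | condFalse _ h => obtain ⟨rfl, rfl⟩ := ih h; exact ⟨rfl, rfl⟩
  | loopTrue hb _ _ ih ih' =>
    intro s₂ t₂ h
    cases h with
    | loopTrue _ h h' =>
      obtain ⟨rfl, rfl⟩ := ih h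
      obtain ⟨rfl, rfl⟩ := ih' h'
      exact ⟨rfl, rfl⟩
    | loopFalse hn => exact absurd hb hn
  | loopFalse hb =>
    intro s₂ t₂ h
    cases h with
    | loopTrue hn _ _ => exact absurd hn hb
    | loopFalse _ => exact ⟨rfl, rfl⟩

/-- Initial memory for an instance: the number `n` of points is in index register `0`, the speed
`v` in real register `0`, the `x`-coordinates in real array `0` and the `y`-coordinates in real
array `1` (positions `0, …, n - 1`); everything else is zero. -/
noncomputable def input (v : ℝ) {n : ℕ} (p : Fin n → ℝ × ℝ) : State where
  idx := fun i => if i = 0 then n else 0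
  reg := fun x => if x = 0 then v else 0
  iarr := fun _ _ => 0
  rarr := fun a i =>
    if h : i < n then
      if a = 0 then (p ⟨i, h⟩).1 else if a = 1 then (p ⟨i, h⟩).2 else 0
    else 0

/-- The output, a point of the plane, is read from real registers `0` and `1`. -/
def State.output (s : State) : ℝ × ℝ := (s.reg 0, s.reg 1)

end RealRAM

/-! ### Elementary properties of travel times -/

/-! Let `δ` be the diameter of `S` for an arbitrary cross `τ`. No leg is faster than `v`, so
`L₁`-distances in `S` are at most `v * δ`; this is the factor `v` for building nothing. The factor
`2 + 1 / v` needs one more fact: `S` has an enclosing cross of width `δ`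
(`exists_subset_stripCross`). Two points either walk directly to each other or both walk to the
cross (`min_le_travelTime`), so every point is close to the cross or close to a point `p` farthest
from it. Strips of width `δ`, shifted from the highways towards `p`, capture both kinds of points. A
smallest enclosing cross therefore has width `w ≤ δ`, and its middle lines serve `p, q` in time `w +
(w + l1Dist p q) / v` (`travelTime_le_of_mem_stripCross`), which is at most `δ + (δ + v * δ) / v`.

Lower bounds on travel times come from potentials (`sub_le_travelTime`). For the bad examples, two
squares of four points and one further point force the median centre to `(-(v / 2), -(v / 2))`. Two
far points on the axes are served well by the cross at the origin, but for the median cross they lie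
in the same quadrant, off both highways, and a potential shows that their travel time is at least `2
* v + 3`.

Minima exist by compactness: projecting the centre to a square containing `S` never makes a cross
worse.

For the algorithm, `v` and `2 + 1 / v` meet at `v = 1 + √2`, and any cross is a factor-`v`
approximation, so median highways achieve `1 + √2` for every speed. They are computed by sorting the
points by `x` and sweeping with two pointers over the ranges of positions covered by the vertical
strip. At each pair of ends, comparing the two extents shows that either the left or the right end
can be discarded for good, so the sweep is linear (`halts_sweepStep`) and bottom-up merge sort
dominates the running time. -/

lemma l1Dist_nonneg (a b : ℝ × ℝ) : 0 ≤ l1Dist a b := by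
  unfold l1Dist; positivity

lemma l1Dist_comm (a b : ℝ × ℝ) : l1Dist a b = l1Dist b a := by
  simp only [l1Dist, abs_sub_comm]

lemma l1Dist_self (a : ℝ × ℝ) : l1Dist a a = 0 := by
  simp [l1Dist]

lemma l1Dist_triangle (a b c : ℝ × ℝ) : l1Dist a c ≤ l1Dist a b + l1Dist b c := by
  have h1 := abs_sub_le a.1 b.1 c.1
  have h2 := abs_sub_le a.2 b.2 c.2
  simp only [l1Dist]; linarith

lemma legTime_comm (v : ℝ) (σ a b : ℝ × ℝ) : legTime v σ a b = legTime v σ b a := by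
  have h : OnCommonHighway σ a b ↔ OnCommonHighway σ b a := by
    unfold OnCommonHighway; tauto
  rw [legTime, legTime, l1Dist_comm a b, propext h]

lemma legTime_le_l1Dist {v : ℝ} (hv : 1 ≤ v) (σ a b : ℝ × ℝ) : legTime v σ a b ≤ l1Dist a b := by
  unfold legTime
  split_ifs
  · exact div_le_self (l1Dist_nonneg a b) hv
  · exact le_rfl

lemma div_le_legTime {v : ℝ} (hv : 1 ≤ v) (σ a b : ℝ × ℝ) :
    l1Dist a b / v ≤ legTime v σ a b := by
  unfold legTime
  split_ifs
  · exact le_rfl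
  · exact div_le_self (l1Dist_nonneg a b) hv

lemma legTime_nonneg {v : ℝ} (hv : 1 ≤ v) (σ a b : ℝ × ℝ) : 0 ≤ legTime v σ a b :=
  (div_nonneg (l1Dist_nonneg a b) (by linarith)).trans (div_le_legTime hv σ a b)

lemma legTime_of_onCommonHighway {v : ℝ} {σ a b : ℝ × ℝ} (h : OnCommonHighway σ a b) :
    legTime v σ a b = l1Dist a b / v := if_pos h

lemma pathTime_nonneg {v : ℝ} (hv : 1 ≤ v) (σ : ℝ × ℝ) (l : List (ℝ × ℝ)) (p q : ℝ × ℝ) :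
    0 ≤ pathTime v σ p l q := by
  induction l generalizing p with
  | nil => exact legTime_nonneg hv σ p q
  | cons a l ih => exact add_nonneg (legTime_nonneg hv σ p a) (ih a)

lemma pathTime_append (v : ℝ) (σ : ℝ × ℝ) (l l' : List (ℝ × ℝ)) (p a q : ℝ × ℝ) :
    pathTime v σ p (l ++ a :: l') q = pathTime v σ p l a + pathTime v σ a l' q := by
  induction l generalizing p with
  | nil => rfl
  | cons b l ih => simp only [List.cons_append, pathTime, ih, add_assoc]

lemma pathTime_reverse (v : ℝ) (σ : ℝ × ℝ) (l : List (ℝ × ℝ)) (p q : ℝ × ℝ) :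
    pathTime v σ q l.reverse p = pathTime v σ p l q := by
  induction l generalizing p with
  | nil => exact legTime_comm v σ q p
  | cons a l ih =>
    rw [List.reverse_cons, pathTime_append, ih]
    simp only [pathTime, legTime_comm v σ a p, add_comm]

lemma travelTime_le_pathTime {v : ℝ} (hv : 1 ≤ v) (σ p q : ℝ × ℝ) (l : List (ℝ × ℝ)) :
    travelTime v σ p q ≤ pathTime v σ p l q :=
  ciInf_le ⟨0, by rintro _ ⟨l, rfl⟩; exact pathTime_nonneg hv σ l p q⟩ l

lemma travelTime_le_legTime {v : ℝ} (hv : 1 ≤ v) (σ p q : ℝ × ℝ) :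
    travelTime v σ p q ≤ legTime v σ p q := travelTime_le_pathTime hv σ p q []

lemma travelTime_le_l1Dist {v : ℝ} (hv : 1 ≤ v) (σ p q : ℝ × ℝ) :
    travelTime v σ p q ≤ l1Dist p q :=
  (travelTime_le_legTime hv σ p q).trans (legTime_le_l1Dist hv σ p q)

lemma travelTime_nonneg {v : ℝ} (hv : 1 ≤ v) (σ p q : ℝ × ℝ) : 0 ≤ travelTime v σ p q :=
  le_ciInf fun l => pathTime_nonneg hv σ l p q

lemma travelTime_comm {v : ℝ} (hv : 1 ≤ v) (σ p q : ℝ × ℝ) :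
    travelTime v σ p q = travelTime v σ q p := by
  apply le_antisymm <;> refine le_ciInf fun l => ?_ <;> rw [← pathTime_reverse] <;>
    exact travelTime_le_pathTime hv _ _ _ _

lemma travelTime_triangle {v : ℝ} (hv : 1 ≤ v) (σ p a q : ℝ × ℝ) :
    travelTime v σ p q ≤ travelTime v σ p a + travelTime v σ a q := by
  rw [← sub_le_iff_le_add]
  refine le_ciInf fun l => ?_
  rw [sub_le_comm]
  refine le_ciInf fun l' => ?_
  have h := travelTime_le_pathTime hv σ p q (l ++ a :: l')
  rw [pathTime_append] at h
  linarith

/-- A function that decreases along each leg by at most the time of the leg bounds travel times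
from below. -/
lemma sub_le_travelTime {v : ℝ} {σ : ℝ × ℝ} (φ : ℝ × ℝ → ℝ)
    (hφ : ∀ a b, φ a - φ b ≤ legTime v σ a b) (p q : ℝ × ℝ) :
    φ p - φ q ≤ travelTime v σ p q := by
  refine le_ciInf fun l => ?_
  induction l generalizing p with
  | nil => exact hφ p q
  | cons a l ih =>
    have h1 := hφ p a
    have h2 := ih a
    simp only [pathTime]
    linarith

/-- No leg is faster than `v`, so the distance to `q` divided by `v` is an admissible potential. -/
lemma l1Dist_div_le_travelTime {v : ℝ} (hv : 1 ≤ v) (σ p q : ℝ × ℝ) :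
    l1Dist p q / v ≤ travelTime v σ p q := by
  have h := sub_le_travelTime (v := v) (σ := σ) (fun a => l1Dist a q / v) (fun a b => ?_) p q
  · simpa [l1Dist_self] using h
  · refine le_trans ?_ (div_le_legTime hv σ a b)
    rw [← sub_div]
    have := l1Dist_triangle a b q
    exact div_le_div_of_nonneg_right (by linarith) (by linarith)

/-- Travel times do not increase under non-expanding maps that respect the highways. -/
lemma travelTime_map_le {v : ℝ} (hv : 1 ≤ v) {σ σ' : ℝ × ℝ} (π : ℝ × ℝ → ℝ × ℝ)
    (hd : ∀ a b, l1Dist (π a) (π b) ≤ l1Dist a b)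
    (hh : ∀ a b, OnCommonHighway σ a b → OnCommonHighway σ' (π a) (π b)) (p q : ℝ × ℝ) :
    travelTime v σ' (π p) (π q) ≤ travelTime v σ p q := by
  have hleg : ∀ a b, legTime v σ' (π a) (π b) ≤ legTime v σ a b := by
    intro a b
    by_cases h : OnCommonHighway σ a b
    · rw [legTime_of_onCommonHighway h, legTime_of_onCommonHighway (hh a b h)]
      exact div_le_div_of_nonneg_right (hd a b) (by linarith)
    · rw [show legTime v σ a b = l1Dist a b from if_neg h]
      exact (legTime_le_l1Dist hv _ _ _).trans (hd a b)
  refine le_ciInf fun l => (travelTime_le_pathTime hv σ' (π p) (π q) (l.map π)).trans ?_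
  induction l generalizing p with
  | nil => exact hleg p q
  | cons a l ih => exact add_le_add (hleg p a) (ih a)

/-! ### Diameters of finite sets -/

lemma le_sSup_pairs {S : Set (ℝ × ℝ)} (hS : S.Finite) (f : ℝ × ℝ → ℝ × ℝ → ℝ) {p q : ℝ × ℝ}
    (hp : p ∈ S) (hq : q ∈ S) : f p q ≤ sSup {t | ∃ p ∈ S, ∃ q ∈ S, t = f p q} := by
  refine le_csSup ?_ ⟨p, hp, q, hq, rfl⟩
  refine ((hS.image2 f hS).subset ?_).bddAbove
  rintro _ ⟨p, hp, q, hq, rfl⟩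
  exact ⟨p, hp, q, hq, rfl⟩

lemma sSup_pairs_le {S : Set (ℝ × ℝ)} (hS : S.Nonempty) (f : ℝ × ℝ → ℝ × ℝ → ℝ) {d : ℝ}
    (h : ∀ p ∈ S, ∀ q ∈ S, f p q ≤ d) : sSup {t | ∃ p ∈ S, ∃ q ∈ S, t = f p q} ≤ d := by
  obtain ⟨p, hp⟩ := hS
  refine csSup_le ⟨_, p, hp, p, hp, rfl⟩ ?_
  rintro _ ⟨p, hp, q, hq, rfl⟩
  exact h p hp q hq

lemma travelTime_le_travelDiam {S : Set (ℝ × ℝ)} (hS : S.Finite) (v : ℝ) (σ : ℝ × ℝ)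
    {p q : ℝ × ℝ} (hp : p ∈ S) (hq : q ∈ S) : travelTime v σ p q ≤ travelDiam v S σ :=
  le_sSup_pairs hS (travelTime v σ) hp hq

lemma travelDiam_le {S : Set (ℝ × ℝ)} (hS : S.Nonempty) {v : ℝ} {σ : ℝ × ℝ} {d : ℝ}
    (h : ∀ p ∈ S, ∀ q ∈ S, travelTime v σ p q ≤ d) : travelDiam v S σ ≤ d :=
  sSup_pairs_le hS (travelTime v σ) h

lemma travelDiam_nonneg {S : Set (ℝ × ℝ)} (hf : S.Finite) (hS : S.Nonempty) {v : ℝ} (hv : 1 ≤ v)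
    (σ : ℝ × ℝ) : 0 ≤ travelDiam v S σ := by
  obtain ⟨p, hp⟩ := hS
  exact (travelTime_nonneg hv σ p p).trans (travelTime_le_travelDiam hf v σ hp hp)

lemma l1Dist_le_mul_travelDiam {S : Set (ℝ × ℝ)} (hf : S.Finite) {v : ℝ} (hv : 1 ≤ v)
    (σ : ℝ × ℝ) {p q : ℝ × ℝ} (hp : p ∈ S) (hq : q ∈ S) :
    l1Dist p q ≤ v * travelDiam v S σ := by
  have h := (l1Dist_div_le_travelTime hv σ p q).trans (travelTime_le_travelDiam hf v σ hp hq)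
  rwa [div_le_iff₀' (by linarith)] at h

lemma l1Diam_le_mul_travelDiam {S : Set (ℝ × ℝ)} (hf : S.Finite) (hS : S.Nonempty) {v : ℝ}
    (hv : 1 ≤ v) (σ : ℝ × ℝ) : l1Diam S ≤ v * travelDiam v S σ :=
  sSup_pairs_le hS l1Dist fun _ hp _ hq => l1Dist_le_mul_travelDiam hf hv σ hp hq

/-! ### Existence of optimal crosses -/

/-- The travel-time diameter is a Lipschitz function of the centre of the cross. -/
lemma travelDiam_le_add {S : Set (ℝ × ℝ)} (hf : S.Finite) (hS : S.Nonempty) {v : ℝ} (hv : 1 ≤ v)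
    (σ σ' : ℝ × ℝ) : travelDiam v S σ' ≤ travelDiam v S σ + 2 * l1Dist σ' σ := by
  refine travelDiam_le hS fun p hp q hq => ?_
  -- Translation by `σ' - σ` carries one cross to the other; reconnecting the two translated
  -- endpoints costs twice the shift.
  have key := travelTime_map_le hv (σ := σ) (σ' := σ') (fun z => z + (σ' - σ))
    (fun a b => by simp [l1Dist]) (fun a b h => by
      rcases h with ⟨h1, h2⟩ | ⟨h1, h2⟩
      · left; simp [h1, h2]
      · right; simp [h1, h2]) p q
  have hs : ∀ z : ℝ × ℝ, l1Dist z (z + (σ' - σ)) = l1Dist σ' σ := by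
    intro z
    simp only [l1Dist, Prod.fst_add, Prod.snd_add, Prod.fst_sub, Prod.snd_sub, sub_add_cancel_left,
      abs_neg]
  have h1 := travelTime_triangle hv σ' p (p + (σ' - σ)) q
  have h2 := travelTime_triangle hv σ' (p + (σ' - σ)) (q + (σ' - σ)) q
  have h3 := travelTime_le_l1Dist hv σ' p (p + (σ' - σ))
  have h4 := travelTime_le_l1Dist hv σ' (q + (σ' - σ)) q
  rw [hs] at h3
  rw [l1Dist_comm, hs] at h4
  have h5 := travelTime_le_travelDiam hf v σ hp hq
  linarith

lemma continuous_travelDiam {S : Set (ℝ × ℝ)} (hf : S.Finite) (hS : S.Nonempty) {v : ℝ}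
    (hv : 1 ≤ v) : Continuous (travelDiam v S) := by
  rw [continuous_iff_continuousAt]
  intro σ
  have h0 : Filter.Tendsto (fun σ' : ℝ × ℝ => 2 * l1Dist σ' σ) (nhds σ) (nhds 0) := by
    have : Continuous fun σ' : ℝ × ℝ => 2 * l1Dist σ' σ := by unfold l1Dist; fun_prop
    simpa [l1Dist_self] using this.tendsto σ
  rw [ContinuousAt, tendsto_iff_dist_tendsto_zero]
  refine squeeze_zero (fun _ => dist_nonneg) (fun σ' => ?_) h0
  rw [Real.dist_eq, abs_le]
  have h1 := travelDiam_le_add hf hS hv σ σ'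
  have h2 := travelDiam_le_add hf hS hv σ' σ
  rw [l1Dist_comm σ σ'] at h2
  constructor <;> linarith

/-- Projection to an axis-parallel square. -/
noncomputable def clampSquare (R : ℝ) (z : ℝ × ℝ) : ℝ × ℝ :=
  (max (-R) (min R z.1), max (-R) (min R z.2))

lemma abs_clamp_sub_clamp_le (R s t : ℝ) :
    |max (-R) (min R s) - max (-R) (min R t)| ≤ |s - t| :=
  (abs_max_sub_max_le_max _ _ _ _).trans <| by
    simpa using abs_min_sub_min_le_max R s R t

lemma clamp_of_abs_le {R s : ℝ} (h : |s| ≤ R) : max (-R) (min R s) = s := by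
  rw [abs_le] at h
  rw [min_eq_right h.2, max_eq_right h.1]

lemma clampSquare_mem {R : ℝ} (hR : 0 ≤ R) (z : ℝ × ℝ) :
    clampSquare R z ∈ Set.Icc (-R) R ×ˢ Set.Icc (-R) R := by
  have h : -R ≤ R := by linarith
  simp [clampSquare, h]

lemma exists_square {S : Set (ℝ × ℝ)} (hf : S.Finite) :
    ∃ R : ℝ, 0 ≤ R ∧ ∀ p ∈ S, |p.1| ≤ R ∧ |p.2| ≤ R := by
  obtain ⟨R, hR⟩ := (hf.image fun p : ℝ × ℝ => |p.1| + |p.2|).bddAbove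
  refine ⟨max R 0, le_max_right _ _, fun p hp => ?_⟩
  have h := hR ⟨p, hp, rfl⟩
  simp only at h
  have h1 := abs_nonneg p.1
  have h2 := abs_nonneg p.2
  have h3 := le_max_left R 0
  constructor <;> linarith

/-- A continuous function of the centre that does not increase when the centre is projected to a
large square attains its minimum. -/
lemma exists_forall_le_of_clampSquare {f : ℝ × ℝ → ℝ} (hc : Continuous f) {R : ℝ} (hR : 0 ≤ R)
    (h : ∀ σ, f (clampSquare R σ) ≤ f σ) : ∃ τ, ∀ σ, f τ ≤ f σ := by
  obtain ⟨τ, -, hτ⟩ := (isCompact_Icc.prod isCompact_Icc).exists_isMinOn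
    ⟨_, clampSquare_mem hR 0⟩ hc.continuousOn
  exact ⟨τ, fun σ => (hτ (clampSquare_mem hR σ)).trans (h σ)⟩

/-- Projection to a square containing `S` is non-expanding, fixes `S` and sends the highways of a
cross into those of the projected cross, so the minimum can be sought over a compact set of centres.
-/
lemma exists_isOptimalCross {S : Set (ℝ × ℝ)} (hf : S.Finite) (hS : S.Nonempty) {v : ℝ}
    (hv : 1 ≤ v) : ∃ τ, IsOptimalCross v S τ := by
  obtain ⟨R, hR, hSR⟩ := exists_square hf
  refine exists_forall_le_of_clampSquare (continuous_travelDiam hf hS hv) hR fun σ => ?_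
  refine travelDiam_le hS fun p hp q hq => ?_
  have h := travelTime_map_le hv (σ := σ) (σ' := clampSquare R σ) (clampSquare R)
    (fun a b => add_le_add (abs_clamp_sub_clamp_le R _ _) (abs_clamp_sub_clamp_le R _ _))
    (fun a b h => by
      rcases h with ⟨h1, h2⟩ | ⟨h1, h2⟩
      · left; simp [clampSquare, h1, h2]
      · right; simp [clampSquare, h1, h2]) p q
  have hfix : ∀ z ∈ S, clampSquare R z = z := fun z hz =>
    Prod.ext (clamp_of_abs_le (hSR z hz).1) (clamp_of_abs_le (hSR z hz).2)
  rw [hfix p hp, hfix q hq] at h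
  exact h.trans (travelTime_le_travelDiam hf v σ hp hq)

/-- The half-width needed at a centre is the largest distance of a point to the cross there. It is
continuous and does not grow under projection of the centre to a square containing `S`. -/
lemma exists_isMedianCross {S : Set (ℝ × ℝ)} (hf : S.Finite) (hS : S.Nonempty) :
    ∃ c, IsMedianCross S c := by
  obtain ⟨R, hR, hSR⟩ := exists_square hf
  have hne : hf.toFinset.Nonempty := by simpa using hS
  set f : ℝ × ℝ → ℝ := fun c => hf.toFinset.sup' hne fun p => min |p.1 - c.1| |p.2 - c.2|
    with hfdef
  have hle : ∀ {c : ℝ × ℝ} {d : ℝ}, f c ≤ d ↔ ∀ p ∈ S, min |p.1 - c.1| |p.2 - c.2| ≤ d := by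
    intro c d
    simp [hfdef, Finset.sup'_le_iff]
  have hc : Continuous f := by
    refine Continuous.finset_sup'_apply hne fun p _ => ?_
    fun_prop
  have hencl : ∀ {c : ℝ × ℝ} {w : ℝ}, S ⊆ stripCross c w ↔ f c ≤ w / 2 := by
    intro c w
    rw [hle]
    simp only [min_le_iff]
    rfl
  obtain ⟨c, hcm⟩ := exists_forall_le_of_clampSquare hc hR (fun σ => by
    rw [hle]
    intro p hp
    have h1 := abs_clamp_sub_clamp_le R p.1 σ.1
    have h2 := abs_clamp_sub_clamp_le R p.2 σ.2
    rw [clamp_of_abs_le (hSR p hp).1] at h1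
    rw [clamp_of_abs_le (hSR p hp).2] at h2
    exact (min_le_min h1 h2).trans (hle.1 le_rfl p hp))
  obtain ⟨p, hp⟩ := hS
  have h0 : 0 ≤ f c := by
    refine le_trans ?_ (hle.1 le_rfl p hp)
    positivity
  refine ⟨c, 2 * f c, by linarith, hencl.2 (by linarith), fun c' w' _ h => ?_⟩
  have h1 := hencl.1 h
  have h2 := hcm c'
  linarith

lemma mem_stripCross {c z : ℝ × ℝ} {w : ℝ} :
    z ∈ stripCross c w ↔ |z.1 - c.1| ≤ w / 2 ∨ |z.2 - c.2| ≤ w / 2 := Iff.rfl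

/-! ### The approximation factor of the median highways -/

/-- Distance to the cross centred at `σ`. -/
noncomputable def crossDist (σ a : ℝ × ℝ) : ℝ := min |a.1 - σ.1| |a.2 - σ.2|

lemma crossDist_le_add (σ a b : ℝ × ℝ) : crossDist σ a ≤ crossDist σ b + l1Dist a b := by
  have h1 := abs_sub_le a.1 b.1 σ.1
  have h2 := abs_sub_le a.2 b.2 σ.2
  have h3 := abs_nonneg (a.1 - b.1)
  have h4 := abs_nonneg (a.2 - b.2)
  unfold crossDist l1Dist
  rcases min_choice |b.1 - σ.1| |b.2 - σ.2| with h | h <;> rw [h, min_le_iff]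
  · left; linarith
  · right; linarith

/-- Two points are either joined directly or both have to reach the cross. -/
lemma min_le_travelTime {v : ℝ} (hv : 1 ≤ v) (σ p q : ℝ × ℝ) :
    min (l1Dist p q) (crossDist σ p + crossDist σ q) ≤ travelTime v σ p q := by
  have hnn : ∀ a, 0 ≤ crossDist σ a := fun a => le_min (abs_nonneg _) (abs_nonneg _)
  have hzero : ∀ a, (a.1 = σ.1 ∨ a.2 = σ.2) → crossDist σ a = 0 := by
    intro a ha
    refine le_antisymm ?_ (hnn a)
    rcases ha with ha | ha <;> simp [crossDist, ha]
  have hon : ∀ a, crossDist σ a = 0 →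
      min (l1Dist p a) (crossDist σ p + crossDist σ a) = crossDist σ p := by
    intro a ha
    have h := crossDist_le_add σ p a
    rw [ha] at h ⊢
    rw [add_zero, min_eq_right (by linarith)]
  -- The negative of the potential bounds the time from `p` when riding along the cross is free:
  -- once the cross is reached, its value stays at `crossDist σ p`.
  have h := sub_le_travelTime (v := v) (σ := σ)
    (fun a => -min (l1Dist p a) (crossDist σ p + crossDist σ a)) (fun a b => ?_) p q
  · rw [l1Dist_self, min_eq_left (by linarith [hnn p])] at h
    linarith
  · by_cases hab : OnCommonHighway σ a b
    · have ha : crossDist σ a = 0 := hzero a (by rcases hab with h | h <;> simp [h.1])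
      have hb : crossDist σ b = 0 := hzero b (by rcases hab with h | h <;> simp [h.2])
      simp only [hon a ha, hon b hb, sub_self]
      exact legTime_nonneg hv σ a b
    · rw [show legTime v σ a b = l1Dist a b from if_neg hab]
      have h1 := l1Dist_triangle p a b
      have h2 := crossDist_le_add σ b a
      rw [l1Dist_comm b a] at h2
      have h3 : min (l1Dist p b) (crossDist σ p + crossDist σ b) ≤
          min (l1Dist p a + l1Dist a b) (crossDist σ p + crossDist σ a + l1Dist a b) :=
        min_le_min h1 (by linarith)
      rw [min_add_add_right] at h3
      linarith

/-- For every cross, there is an enclosing cross whose width is the travel-time diameter. -/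
lemma exists_subset_stripCross {S : Set (ℝ × ℝ)} (hf : S.Finite) (hS : S.Nonempty) {v : ℝ}
    (hv : 1 ≤ v) (τ : ℝ × ℝ) : ∃ c, S ⊆ stripCross c (travelDiam v S τ) := by
  obtain ⟨p, hp, hmax⟩ := hf.exists_maximalFor (crossDist τ) S hS
  replace hmax : ∀ q ∈ S, crossDist τ q ≤ crossDist τ p := fun q hq =>
    (le_total (crossDist τ p) (crossDist τ q)).elim (hmax hq) id
  set δ := travelDiam v S τ
  set h := crossDist τ p with hdef
  by_cases hh : h ≤ δ / 2
  · refine ⟨τ, fun q hq => ?_⟩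
    exact min_le_iff.1 ((hmax q hq).trans hh)
  push Not at hh
  have hsign : ∀ x : ℝ, ∃ e : ℝ, (e = 1 ∨ e = -1) ∧ e * x = |x| := by
    intro x
    rcases abs_choice x with hx | hx
    · exact ⟨1, Or.inl rfl, by rw [hx, one_mul]⟩
    · exact ⟨-1, Or.inr rfl, by rw [hx, neg_one_mul]⟩
  obtain ⟨e, he, hep⟩ := hsign (p.1 - τ.1)
  obtain ⟨e', he', hep'⟩ := hsign (p.2 - τ.2)
  have habs : ∀ e : ℝ, (e = 1 ∨ e = -1) → ∀ x : ℝ, |e * x| = |x| := by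
    rintro e (rfl | rfl) x <;> simp
  have hp1 : h ≤ |p.1 - τ.1| := min_le_left _ _
  have hp2 : h ≤ |p.2 - τ.2| := min_le_right _ _
  -- In coordinates centred at `τ` and reflected so that `p` has non-negative coordinates, both
  -- strips become `[h - δ, h]`.
  refine ⟨(τ.1 + e * (h - δ / 2), τ.2 + e' * (h - δ / 2)), fun q hq => ?_⟩
  have hq1 : q.1 - (τ.1 + e * (h - δ / 2)) = e * (e * (q.1 - τ.1) - (h - δ / 2)) := by
    rcases he with rfl | rfl <;> ring
  have hq2 : q.2 - (τ.2 + e' * (h - δ / 2)) = e' * (e' * (q.2 - τ.2) - (h - δ / 2)) := by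
    rcases he' with rfl | rfl <;> ring
  have hgoal : (|e * (q.1 - τ.1) - (h - δ / 2)| ≤ δ / 2 ∨ |e' * (q.2 - τ.2) - (h - δ / 2)| ≤ δ / 2) →
      q ∈ stripCross (τ.1 + e * (h - δ / 2), τ.2 + e' * (h - δ / 2)) δ := by
    intro H
    rwa [mem_stripCross, hq1, hq2, habs e he, habs e' he']
  apply hgoal
  have hx := habs e he (q.1 - τ.1)
  have hy := habs e' he' (q.2 - τ.2)
  have hdx := habs e he (p.1 - q.1)
  have hdy := habs e' he' (p.2 - q.2)
  have hdx' : e * (p.1 - q.1) = |p.1 - τ.1| - e * (q.1 - τ.1) := by rw [← hep]; ring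
  have hdy' : e' * (p.2 - q.2) = |p.2 - τ.2| - e' * (q.2 - τ.2) := by rw [← hep']; ring
  rw [hdx'] at hdx
  rw [hdy'] at hdy
  have hmq := hmax q hq
  have ht := (min_le_travelTime hv τ p q).trans (travelTime_le_travelDiam hf v τ hp hq)
  generalize e * (q.1 - τ.1) = X at *
  generalize e' * (q.2 - τ.2) = Y at *
  simp only [crossDist, ← hx, ← hy] at hmq ht
  -- If `q` is within `δ` of `p`, both its coordinates are at least `h - δ`, and one is at most `h`
  -- because `p` is farthest from the cross. Otherwise `q` is within `δ - h` of the cross, hence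
  -- inside `[h - δ, h]` in one coordinate.
  rcases min_le_iff.1 ht with ht | ht
  · simp only [l1Dist] at ht
    rw [← hdx, ← hdy] at ht
    have a1 := le_abs_self (|p.1 - τ.1| - X)
    have a2 := le_abs_self (|p.2 - τ.2| - Y)
    have a3 := abs_nonneg (|p.1 - τ.1| - X)
    have a4 := abs_nonneg (|p.2 - τ.2| - Y)
    rcases min_le_iff.1 hmq with hm | hm
    · left
      have := le_abs_self X
      rw [abs_le]; constructor <;> linarith
    · right
      have := le_abs_self Y
      rw [abs_le]; constructor <;> linarith
  · have ht' : min |X| |Y| ≤ δ - h := by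
      have h2 : min |p.1 - τ.1| |p.2 - τ.2| = h := rfl
      rw [h2] at ht
      linarith
    rcases min_le_iff.1 ht' with hm | hm
    · left
      rw [abs_le] at hm ⊢; constructor <;> linarith
    · right
      rw [abs_le] at hm ⊢; constructor <;> linarith

/-- Travel time between two points of an enclosing cross when driving along its middle lines. -/
lemma travelTime_le_of_mem_stripCross {v : ℝ} (hv : 1 ≤ v) {c p q : ℝ × ℝ} {w : ℝ}
    (hp : p ∈ stripCross c w) (hq : q ∈ stripCross c w) :
    travelTime v c p q ≤ w + (w + l1Dist p q) / v := by
  have hv0 : 0 < v := by linarith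
  rw [mem_stripCross] at hp hq
  have step : ∀ {a b a' b' : ℝ × ℝ}, travelTime v c a b ≤
      l1Dist a a' + travelTime v c a' b' + l1Dist b' b := by
    intro a b a' b'
    have h1 := travelTime_triangle hv c a a' b
    have h2 := travelTime_triangle hv c a' b' b
    have h3 := travelTime_le_l1Dist hv c a a'
    have h4 := travelTime_le_l1Dist hv c b' b
    linarith
  have hw : 0 ≤ w := by
    rcases hp with hp | hp <;> linarith [(abs_nonneg _).trans hp]
  have same : ∀ {a b : ℝ × ℝ}, OnCommonHighway c a b → travelTime v c a b ≤ l1Dist a b / v :=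
    fun {a b} h => (travelTime_le_legTime hv c a b).trans (legTime_of_onCommonHighway h).le
  -- When the points lie in different strips the route turns at `c`. Each of its two highway parts
  -- exceeds the corresponding coordinate difference of `p` and `q` by at most `w / 2`.
  have bend : ∀ {p q : ℝ × ℝ}, |p.1 - c.1| ≤ w / 2 → |q.2 - c.2| ≤ w / 2 →
      travelTime v c p q ≤ w + (w + l1Dist p q) / v := by
    intro p q hp hq
    have h1 := step (a := p) (b := q) (a' := (c.1, p.2)) (b' := (q.1, c.2))
    have h2 := travelTime_triangle hv c (c.1, p.2) c (q.1, c.2)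
    have h3 := same (a := (c.1, p.2)) (b := c) (Or.inl ⟨rfl, rfl⟩)
    have h4 := same (a := c) (b := (q.1, c.2)) (Or.inr ⟨rfl, rfl⟩)
    simp only [l1Dist, sub_self, abs_zero, add_zero, zero_add] at h1 h3 h4
    have h5 : (|p.2 - c.2| + |c.1 - q.1|) / v ≤ (w + l1Dist p q) / v := by
      refine div_le_div_of_nonneg_right ?_ hv0.le
      have a1 := abs_sub_le p.2 q.2 c.2
      have a2 := abs_sub_le c.1 p.1 q.1
      rw [abs_sub_comm c.1 p.1] at a2
      simp only [l1Dist]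
      linarith
    rw [add_div] at h5
    rw [abs_sub_comm c.2 q.2] at h1
    linarith
  have hfin : l1Dist p q / v ≤ (w + l1Dist p q) / v :=
    div_le_div_of_nonneg_right (by linarith) hv0.le
  rcases hp with hp | hp <;> rcases hq with hq | hq
  · have h1 := step (a := p) (b := q) (a' := (c.1, p.2)) (b' := (c.1, q.2))
    have h3 := same (a := (c.1, p.2)) (b := (c.1, q.2)) (Or.inl ⟨rfl, rfl⟩)
    have h4 : |p.2 - q.2| / v ≤ l1Dist p q / v :=
      div_le_div_of_nonneg_right (le_add_of_nonneg_left (abs_nonneg _)) hv0.le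
    simp only [l1Dist, sub_self, abs_zero, add_zero, zero_add] at h1 h3 h4 hp hq hfin ⊢
    rw [abs_sub_comm c.1 q.1] at h1
    linarith
  · exact bend hp hq
  · rw [travelTime_comm hv, l1Dist_comm]
    exact bend hq hp
  · have h1 := step (a := p) (b := q) (a' := (p.1, c.2)) (b' := (q.1, c.2))
    have h3 := same (a := (p.1, c.2)) (b := (q.1, c.2)) (Or.inr ⟨rfl, rfl⟩)
    have h4 : |p.1 - q.1| / v ≤ l1Dist p q / v :=
      div_le_div_of_nonneg_right (le_add_of_nonneg_right (abs_nonneg _)) hv0.le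
    simp only [l1Dist, sub_self, abs_zero, add_zero, zero_add] at h1 h3 h4 hp hq hfin ⊢
    rw [abs_sub_comm c.2 q.2] at h1
    linarith

/-- Both quantities in the time bound are controlled by the diameter `δ` for `τ`: the width by `δ`,
and `L₁`-distances by `v * δ`. -/
lemma IsMedianCross.travelDiam_le {S : Set (ℝ × ℝ)} (hf : S.Finite) (hS : S.Nonempty) {v : ℝ}
    (hv : 1 ≤ v) {c : ℝ × ℝ} (hc : IsMedianCross S c) (τ : ℝ × ℝ) :
    travelDiam v S c ≤ (2 + 1 / v) * travelDiam v S τ := by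
  obtain ⟨w, -, hencl, hmin⟩ := hc
  obtain ⟨c', hc'⟩ := exists_subset_stripCross hf hS hv τ
  have hw := hmin c' _ (travelDiam_nonneg hf hS hv τ) hc'
  refine _root_.travelDiam_le hS fun p hp q hq => ?_
  refine (travelTime_le_of_mem_stripCross hv (hencl hp) (hencl hq)).trans ?_
  have h1 := l1Dist_le_mul_travelDiam hf hv τ hp hq
  have hv0 : 0 < v := by linarith
  generalize travelDiam v S τ = δ at *
  calc w + (w + l1Dist p q) / v ≤ δ + (δ + v * δ) / v := by gcongr
    _ = (2 + 1 / v) * δ := by field_simp; ring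

/-! ### Point sets for which the median highways are bad -/

/-- Time between two points `(a, B)` and `(B, a)` in the inner corner of the cross. -/
lemma le_travelTime_corner {v : ℝ} (hv : √3 ≤ v) {c p q : ℝ × ℝ}
    (hp1 : p.1 - c.1 = v / 2) (hp2 : p.2 - c.2 = v * (v + 3) / 2)
    (hq1 : q.1 - c.1 = v * (v + 3) / 2) (hq2 : q.2 - c.2 = v / 2) :
    2 * v + 3 ≤ travelTime v c p q := by
  have hv3 : 3 ≤ v ^ 2 := by
    have h := Real.sq_sqrt (show (0 : ℝ) ≤ 3 by norm_num)
    have h0 := Real.sqrt_nonneg 3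
    nlinarith
  have hv1 : 3 / 2 ≤ v := by
    by_contra! h
    have h0 := Real.sqrt_nonneg 3
    nlinarith
  have hv0 : 0 < v := by linarith
  have hle : ∀ x : ℝ, |x| / v ≤ |x| := fun x => div_le_self (abs_nonneg x) (by linarith)
  have hdiv : ∀ x y : ℝ, x / v - y / v ≤ |x - y| / v := fun x y => by
    rw [← sub_div]; exact div_le_div_of_nonneg_right (le_abs_self _) hv0.le
  -- The intended route walks to the vertical highway, rides to the centre, rides along the
  -- horizontal highway and walks to `q`. `φ` is the time relative to the centre along it: `y / v`
  -- on the vertical highway and `-(x / v)` on the horizontal one, in coordinates centred at `c`.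
  -- The third term, a shifted distance to `q`, lowers the value at `q` to `-(v + 3 / 2)`.
  set φ : ℝ × ℝ → ℝ := fun z =>
    min (min (|z.1 - c.1| + (z.2 - c.2) / v) (|z.2 - c.2| - (z.1 - c.1) / v))
      (l1Dist z q - (v + 3 / 2)) with hφ
  have hl1q : ∀ z : ℝ × ℝ, l1Dist z q =
      |z.1 - c.1 - v * (v + 3) / 2| + |z.2 - c.2 - v / 2| := by
    intro z
    simp only [l1Dist, ← hq1, ← hq2, sub_sub_sub_cancel_right]
  have hBv : v * (v + 3) / 2 / v = (v + 3) / 2 := by field_simp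
  have hav : v / 2 / v = 1 / 2 := by field_simp
  have hvert : ∀ z : ℝ × ℝ, z.1 = c.1 → φ z = (z.2 - c.2) / v := by
    intro z hz
    have h1 := hle (z.2 - c.2)
    have h2 := le_abs_self (z.2 - c.2)
    have h3 := hdiv (z.2 - c.2) (v / 2)
    have h4 := hle (z.2 - c.2 - v / 2)
    have h5 : (z.2 - c.2) / v ≤ |z.2 - c.2| / v := div_le_div_of_nonneg_right h2 hv0.le
    rw [hav] at h3
    have h7 : (z.2 - c.2) / v ≤ l1Dist z q - (v + 3 / 2) := by
      rw [hl1q, hz, sub_self, zero_sub, abs_neg, abs_of_nonneg (by positivity)]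
      nlinarith
    simp only [hφ, hz, sub_self, abs_zero, zero_add, zero_div, sub_zero]
    rw [min_eq_left (h5.trans h1), min_eq_left h7]
  have hhor : ∀ z : ℝ × ℝ, z.2 = c.2 → φ z = -((z.1 - c.1) / v) := by
    intro z hz
    have h1 := hle (z.1 - c.1)
    have h2 := neg_abs_le (z.1 - c.1)
    have h3 := hdiv (v * (v + 3) / 2) (z.1 - c.1)
    have h4 := hle (v * (v + 3) / 2 - (z.1 - c.1))
    have h5 : -|z.1 - c.1| / v ≤ (z.1 - c.1) / v := div_le_div_of_nonneg_right h2 hv0.le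
    rw [hBv] at h3
    rw [neg_div] at h5
    have h7 : -((z.1 - c.1) / v) ≤ l1Dist z q - (v + 3 / 2) := by
      rw [hl1q, hz, sub_self, zero_sub, abs_neg, abs_of_nonneg (show 0 ≤ v / 2 by positivity),
        abs_sub_comm]
      linarith
    simp only [hφ, hz, sub_self, abs_zero, zero_div, add_zero, zero_sub]
    rw [min_eq_right (a := |z.1 - c.1|) (by linarith), min_eq_left h7]
  have hlip : ∀ a b, φ a - φ b ≤ l1Dist a b := by
    intro a b
    have e1 := abs_sub_abs_le_abs_sub (a.1 - c.1) (b.1 - c.1)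
    have e2 := abs_sub_abs_le_abs_sub (a.2 - c.2) (b.2 - c.2)
    have e3 := hdiv (a.2 - c.2) (b.2 - c.2)
    have e4 := hdiv (b.1 - c.1) (a.1 - c.1)
    rw [abs_sub_comm] at e4
    rw [sub_sub_sub_cancel_right] at e1 e2 e3 e4
    have e5 := hle (a.1 - b.1)
    have e6 := hle (a.2 - b.2)
    have e7 := l1Dist_triangle a b q
    rw [sub_le_iff_le_add]
    simp only [hφ]
    rw [← min_add_add_left, ← min_add_add_left]
    refine min_le_min (min_le_min ?_ ?_) ?_
    · simp only [l1Dist]; linarith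
    · simp only [l1Dist]; linarith
    · linarith
  have h := sub_le_travelTime (v := v) (σ := c) φ (fun a b => ?_) p q
  · have hq : φ q ≤ -(v + 3 / 2) := by
      refine (min_le_right _ _).trans ?_
      rw [l1Dist_self]; linarith
    have hp : v + 3 / 2 ≤ φ p := by
      refine le_min (le_min ?_ ?_) ?_
      · rw [hp1, hp2, hBv, abs_of_nonneg (by linarith)]; linarith
      · rw [hp1, hp2, hav, abs_of_nonneg (by positivity)]; nlinarith
      -- The direct walk takes time `v * (v + 2)`, which is at least `2 * v + 3` exactly when `3 ≤ v
      -- ^ 2`; this is where the threshold `√3` comes from.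
      · rw [hl1q, hp1, hp2]
        have a1 := neg_abs_le (v / 2 - v * (v + 3) / 2)
        have a2 := le_abs_self (v * (v + 3) / 2 - v / 2)
        nlinarith
    linarith
  · by_cases hab : OnCommonHighway c a b
    · rw [legTime_of_onCommonHighway hab]
      rcases hab with ⟨ha, hb⟩ | ⟨ha, hb⟩
      · rw [hvert a ha, hvert b hb, l1Dist, ha, hb, sub_self, abs_zero, zero_add]
        simpa using hdiv (a.2 - c.2) (b.2 - c.2)
      · rw [hhor a ha, hhor b hb, l1Dist, ha, hb, sub_self, abs_zero, add_zero]
        have := hdiv (b.1 - c.1) (a.1 - c.1)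
        rw [sub_sub_sub_cancel_right, abs_sub_comm] at this
        linarith
    · rw [show legTime v c a b = l1Dist a b from if_neg hab]
      exact hlip a b

/-- A point set with bad median highways. -/
def badSet (v : ℝ) : Set (ℝ × ℝ) :=
  {(0, v * (v + 2) / 2), (v * (v + 2) / 2, 0),
    (0, v / 2), (0, -(v / 2)), (-v, v / 2), (-v, -(v / 2)),
    (v / 2, 0), (-(v / 2), 0), (v / 2, -v), (-(v / 2), -v),
    (-(v / 2 + 1 / 4), -(v / 2 + 1 / 4))}

lemma badSet_finite (v : ℝ) : (badSet v).Finite := by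
  simp [badSet]

lemma badSet_nonempty (v : ℝ) : (badSet v).Nonempty := ⟨_, Set.mem_insert _ _⟩

lemma three_le_ncard_badSet {v : ℝ} (hv : 0 < v) : 3 ≤ (badSet v).ncard := by
  have hsub : {(0, v / 2), (0, -(v / 2)), (-v, v / 2)} ⊆ badSet v := by
    rintro z (rfl | rfl | rfl) <;> simp [badSet]
  have h3 : ({(0, v / 2), (0, -(v / 2)), (-v, v / 2)} : Set (ℝ × ℝ)).ncard = 3 := by
    refine Set.ncard_eq_three.2 ⟨_, _, _, ?_, ?_, ?_, rfl⟩ <;> simp only [ne_eq, Prod.mk.injEq, not_and]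
    · intro _ h; linarith
    · intro h; linarith
    · intro h; linarith
  rw [← h3]
  exact Set.ncard_le_ncard hsub (badSet_finite v)

/-- The cross centred at the origin is good for `badSet v`: each point reaches the origin within
time `(v + 2) / 2`. -/
lemma travelDiam_badSet_le {v : ℝ} (hv : 1 < v) : travelDiam v (badSet v) 0 ≤ v + 2 := by
  have hv0 : 0 < v := by linarith
  have hV : ∀ y : ℝ, travelTime v 0 (0, y) 0 ≤ |y| / v := by
    intro y
    have h := travelTime_le_legTime hv.le 0 (0, y) 0
    rw [legTime_of_onCommonHighway (σ := 0) (a := (0, y)) (b := 0) (Or.inl ⟨rfl, rfl⟩)] at h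
    simpa [l1Dist] using h
  have hH : ∀ x : ℝ, travelTime v 0 (x, 0) 0 ≤ |x| / v := by
    intro x
    have h := travelTime_le_legTime hv.le 0 (x, 0) 0
    rw [legTime_of_onCommonHighway (σ := 0) (a := (x, 0)) (b := 0) (Or.inr ⟨rfl, rfl⟩)] at h
    simpa [l1Dist] using h
  have hgenH : ∀ x y : ℝ, travelTime v 0 (x, y) 0 ≤ |y| + |x| / v := by
    intro x y
    have h1 := travelTime_triangle hv.le 0 (x, y) (x, 0) 0
    have h2 := travelTime_le_l1Dist hv.le 0 (x, y) (x, 0)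
    have h3 := hH x
    simp only [l1Dist, sub_self, abs_zero, zero_add, sub_zero] at h2
    linarith
  have hgenV : ∀ x y : ℝ, travelTime v 0 (x, y) 0 ≤ |x| + |y| / v := by
    intro x y
    have h1 := travelTime_triangle hv.le 0 (x, y) (0, y) 0
    have h2 := travelTime_le_l1Dist hv.le 0 (x, y) (0, y)
    have h3 := hV y
    simp only [l1Dist, sub_self, abs_zero, add_zero, sub_zero] at h2
    linarith
  have e1 : |v / 2| = v / 2 := abs_of_pos (by linarith)
  have e2 : |v| = v := abs_of_pos hv0
  have e3 : |v * (v + 2) / 2| = v * (v + 2) / 2 := abs_of_pos (by positivity)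
  have e4 : |v / 2 + 1 / 4| = v / 2 + 1 / 4 := abs_of_pos (by positivity)
  have d1 : v / 2 / v = 1 / 2 := by field_simp
  have d2 : v / v = 1 := by field_simp
  have d3 : v * (v + 2) / 2 / v = (v + 2) / 2 := by field_simp
  -- The offset `1 / 4` leaves `3 / 4` of the allowed time `v / 2 + 1` for the ride.
  have d4 : (v / 2 + 1 / 4) / v ≤ 3 / 4 := by
    rw [div_le_iff₀ hv0]; linarith
  have hreach : ∀ p ∈ badSet v, travelTime v 0 p 0 ≤ (v + 2) / 2 := by
    rintro p (rfl | rfl | rfl | rfl | rfl | rfl | rfl | rfl | rfl | rfl | rfl)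
    · exact (hV _).trans (by rw [e3, d3])
    · exact (hH _).trans (by rw [e3, d3])
    · exact (hV _).trans (by rw [e1, d1]; linarith)
    · exact (hV _).trans (by rw [abs_neg, e1, d1]; linarith)
    · exact (hgenH _ _).trans (by rw [abs_neg, e1, e2, d2]; linarith)
    · exact (hgenH _ _).trans (by rw [abs_neg, abs_neg, e1, e2, d2]; linarith)
    · exact (hH _).trans (by rw [e1, d1]; linarith)
    · exact (hH _).trans (by rw [abs_neg, e1, d1]; linarith)
    · exact (hgenV _ _).trans (by rw [abs_neg, e1, e2, d2]; linarith)
    · exact (hgenV _ _).trans (by rw [abs_neg, abs_neg, e1, e2, d2]; linarith)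
    · exact (hgenV _ _).trans (by rw [abs_neg, e4]; linarith)
  refine travelDiam_le (badSet_nonempty v) fun p hp q hq => ?_
  have h := travelTime_triangle hv.le 0 p 0 q
  rw [travelTime_comm hv.le 0 0 q] at h
  linarith [hreach p hp, hreach q hq]

/-- Two groups of four points are the corners of `v × v` squares centred at `(-(v / 2), 0)` and `(0,
-(v / 2))`. They leave only two centres for a cross of width at most `v`, and the last point of
`badSet` rules out the origin. -/
lemma eq_of_isMedianCross_badSet {v : ℝ} (hv : 1 < v) {c : ℝ × ℝ}
    (hc : IsMedianCross (badSet v) c) : c = (-(v / 2), -(v / 2)) := by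
  obtain ⟨w, -, hencl, hmin⟩ := hc
  have hwv : w ≤ v := by
    refine hmin (-(v / 2), -(v / 2)) v (by linarith) fun p hp => ?_
    rw [mem_stripCross, abs_le, abs_le]
    rcases hp with rfl | rfl | rfl | rfl | rfl | rfl | rfl | rfl | rfl | rfl | rfl
    all_goals first
      | (left; constructor <;> dsimp only <;> linarith)
      | (right; constructor <;> dsimp only <;> linarith)
  have hmem : ∀ p ∈ badSet v, (-(v / 2) ≤ p.1 - c.1 ∧ p.1 - c.1 ≤ v / 2) ∨
      (-(v / 2) ≤ p.2 - c.2 ∧ p.2 - c.2 ≤ v / 2) := by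
    intro p hp
    rw [← abs_le, ← abs_le]
    exact (mem_stripCross.1 (hencl hp)).imp (fun h => by linarith) (fun h => by linarith)
  have a1 := hmem (0, v / 2) (by simp [badSet])
  have a2 := hmem (0, -(v / 2)) (by simp [badSet])
  have a3 := hmem (-v, v / 2) (by simp [badSet])
  have a4 := hmem (-v, -(v / 2)) (by simp [badSet])
  have b1 := hmem (v / 2, 0) (by simp [badSet])
  have b2 := hmem (-(v / 2), 0) (by simp [badSet])
  have b3 := hmem (v / 2, -v) (by simp [badSet])
  have b4 := hmem (-(v / 2), -v) (by simp [badSet])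
  have k := hmem (-(v / 2 + 1 / 4), -(v / 2 + 1 / 4)) (by simp [badSet])
  obtain ⟨x, y⟩ := c
  dsimp only at a1 a2 a3 a4 b1 b2 b3 b4 k
  -- If the centre lies on neither middle line of the square, the corner in the opposite direction
  -- is outside both strips.
  have hA : x = -(v / 2) ∨ y = 0 := by
    by_contra! h
    obtain ⟨h1, h2⟩ := h
    rcases lt_or_gt_of_ne h1 with h1 | h1 <;> rcases lt_or_gt_of_ne h2 with h2 | h2
    · rcases a1 with a | a <;> linarith [a.1, a.2]
    · rcases a2 with a | a <;> linarith [a.1, a.2]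
    · rcases a3 with a | a <;> linarith [a.1, a.2]
    · rcases a4 with a | a <;> linarith [a.1, a.2]
  have hB : y = -(v / 2) ∨ x = 0 := by
    by_contra! h
    obtain ⟨h1, h2⟩ := h
    rcases lt_or_gt_of_ne h1 with h1 | h1 <;> rcases lt_or_gt_of_ne h2 with h2 | h2
    · rcases b1 with a | a <;> linarith [a.1, a.2]
    · rcases b2 with a | a <;> linarith [a.1, a.2]
    · rcases b3 with a | a <;> linarith [a.1, a.2]
    · rcases b4 with a | a <;> linarith [a.1, a.2]
  rcases hA with hA | hA <;> rcases hB with hB | hB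
  · rw [hA, hB]
  · linarith
  · linarith
  · exfalso
    rcases k with k | k <;> linarith [k.1, k.2]

lemma le_travelDiam_badSet {v : ℝ} (hv : √3 ≤ v) {c : ℝ × ℝ} (hc : IsMedianCross (badSet v) c) :
    2 * v + 3 ≤ travelDiam v (badSet v) c := by
  have hv1 : 1 < v := lt_of_lt_of_le (Real.lt_sqrt_of_sq_lt (by norm_num)) hv
  rw [eq_of_isMedianCross_badSet hv1 hc]
  refine (le_travelTime_corner hv (p := (0, v * (v + 2) / 2)) (q := (v * (v + 2) / 2, 0))
    ?_ ?_ ?_ ?_).trans (travelTime_le_travelDiam (badSet_finite v) v _ (by simp [badSet])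
      (by simp [badSet])) <;> dsimp only <;> ring

lemma exists_bad_median_cross {v : ℝ} (hv : √3 ≤ v) :
    ∃ S : Set (ℝ × ℝ), S.Finite ∧ 3 ≤ S.ncard ∧
      ∀ c τ, IsMedianCross S c → IsOptimalCross v S τ →
        (2 - 1 / (v + 2)) * travelDiam v S τ ≤ travelDiam v S c := by
  have hv1 : 1 < v := lt_of_lt_of_le (Real.lt_sqrt_of_sq_lt (by norm_num)) hv
  refine ⟨badSet v, badSet_finite v, three_le_ncard_badSet (by linarith), fun c τ hc hτ => ?_⟩
  have hpos : 0 ≤ 2 - 1 / (v + 2) := by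
    have : 1 / (v + 2) ≤ 1 := by rw [div_le_one (by linarith)]; linarith
    linarith
  calc (2 - 1 / (v + 2)) * travelDiam v (badSet v) τ ≤ (2 - 1 / (v + 2)) * (v + 2) :=
        mul_le_mul_of_nonneg_left ((hτ 0).trans (travelDiam_badSet_le hv1)) hpos
    _ = 2 * v + 3 := by field_simp; ring
    _ ≤ travelDiam v (badSet v) c := le_travelDiam_badSet hv hc

/-! ### Smallest enclosing crosses of points sorted by their `x`-coordinates

The points are `(X t, Y t)` for `a ≤ t < b`. -/

/-- The points of a segment of a pair of arrays. -/
def segmentPoints (X Y : ℕ → ℝ) (a b : ℕ) : Set (ℝ × ℝ) := {z | ∃ t, a ≤ t ∧ t < b ∧ z = (X t, Y t)}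

/-- A cross of width `w` encloses the points if its vertical strip covers the positions
`i, …, j`. -/
def Coverable (X Y : ℕ → ℝ) (a b i j : ℕ) (w : ℝ) : Prop :=
  X j - X i ≤ w ∧ ∀ t u, a ≤ t → t < b → a ≤ u → u < b → (t < i ∨ j < t) → (u < i ∨ j < u) →
    Y t - Y u ≤ w

/-- This reduces arbitrary crosses to pairs of positions: take the first and the last point in the
vertical strip. All points outside that range must lie in the horizontal strip. -/
lemma exists_coverable {X Y : ℕ → ℝ} {a b : ℕ} (hab : a < b) {c : ℝ × ℝ} {w : ℝ} (hw : 0 ≤ w)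
    (h : segmentPoints X Y a b ⊆ stripCross c w) :
    ∃ i j, a ≤ i ∧ i < b ∧ a ≤ j ∧ j < b ∧ Coverable X Y a b i j w := by
  classical
  have hstrip : ∀ t, a ≤ t → t < b → |X t - c.1| ≤ w / 2 ∨ |Y t - c.2| ≤ w / 2 :=
    fun t h1 h2 => mem_stripCross.1 (h ⟨t, h1, h2, rfl⟩)
  have hY : ∀ t u, |Y t - c.2| ≤ w / 2 → |Y u - c.2| ≤ w / 2 → Y t - Y u ≤ w := by
    intro t u ht hu
    rw [abs_le] at ht hu
    linarith [ht.2, hu.1]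
  set I := (Finset.Ico a b).filter fun t => |X t - c.1| ≤ w / 2
  have hI : ∀ t, t ∈ I ↔ (a ≤ t ∧ t < b) ∧ |X t - c.1| ≤ w / 2 := fun t => by simp [I]
  by_cases hne : I.Nonempty
  · have hi := (hI _).1 (I.min'_mem hne)
    have hj := (hI _).1 (I.max'_mem hne)
    refine ⟨I.min' hne, I.max' hne, hi.1.1, hi.1.2, hj.1.1, hj.1.2, ?_, ?_⟩
    · have h1 := abs_le.1 hi.2
      have h2 := abs_le.1 hj.2
      linarith [h1.1, h2.2]
    · have key : ∀ t, a ≤ t → t < b → (t < I.min' hne ∨ I.max' hne < t) →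
          |Y t - c.2| ≤ w / 2 := by
        intro t h1 h2 h3
        refine (hstrip t h1 h2).resolve_left fun h4 => ?_
        have hm := (hI t).2 ⟨⟨h1, h2⟩, h4⟩
        have h5 := I.min'_le t hm
        have h6 := I.le_max' t hm
        omega
      intro t u h1 h2 h3 h4 h5 h6
      exact hY t u (key t h1 h2 h5) (key u h3 h4 h6)
  -- With an empty vertical strip any single position will do, since the horizontal strip contains
  -- everything.
  · refine ⟨a, a, le_rfl, hab, le_rfl, hab, by simpa using hw, ?_⟩
    have key : ∀ t, a ≤ t → t < b → |Y t - c.2| ≤ w / 2 := fun t h1 h2 =>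
      (hstrip t h1 h2).resolve_left fun h4 => hne ⟨t, (hI t).2 ⟨⟨h1, h2⟩, h4⟩⟩
    intro t u h1 h2 h3 h4 _ _
    exact hY t u (key t h1 h2) (key u h3 h4)

/-- The `y`-coordinates outside positions `i, …, j`, preceded by a default value `d`. -/
def outerValues (Y : ℕ → ℝ) (a b i j : ℕ) (d : ℝ) : Set ℝ :=
  insert d (Y '' Set.Ico a i) ∪ insert d (Y '' Set.Ico (j + 1) b)

lemma mem_outerValues {Y : ℕ → ℝ} {a b i j : ℕ} {d : ℝ} {t : ℕ} (h1 : a ≤ t) (h2 : t < b)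
    (h : t < i ∨ j < t) : Y t ∈ outerValues Y a b i j d := by
  rcases h with h | h
  · exact Or.inl (Or.inr ⟨t, ⟨h1, h⟩, rfl⟩)
  · exact Or.inr (Or.inr ⟨t, ⟨h, h2⟩, rfl⟩)

lemma eq_or_of_mem_outerValues {Y : ℕ → ℝ} {a b i j : ℕ} {d z : ℝ} (hi : i ≤ b) (hj : a ≤ j)
    (h : z ∈ outerValues Y a b i j d) :
    z = d ∨ ∃ t, a ≤ t ∧ t < b ∧ (t < i ∨ j < t) ∧ Y t = z := by
  rcases h with (h | ⟨t, ht, rfl⟩) | (h | ⟨t, ht, rfl⟩)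
  · exact Or.inl h
  · exact Or.inr ⟨t, ht.1, lt_of_lt_of_le ht.2 hi, Or.inl ht.2, rfl⟩
  · exact Or.inl h
  · have := ht.1
    exact Or.inr ⟨t, by omega, ht.2, Or.inr (by omega), rfl⟩

section

variable {X Y : ℕ → ℝ} {a b i j : ℕ} {m M lo hi w : ℝ}

/-- The cross given by positions `i, j` and the remaining `y`-coordinates is enclosing. -/
lemma segmentPoints_subset_stripCross (hX : ∀ t u, a ≤ t → t ≤ u → u < b → X t ≤ X u)
    (hi' : a ≤ i) (hj' : j < b)
    (hlo : IsLeast (outerValues Y a b i j M) lo) (hhi : IsGreatest (outerValues Y a b i j m) hi)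
    (h1 : X j - X i ≤ w) (h2 : hi - lo ≤ w) :
    segmentPoints X Y a b ⊆ stripCross ((X j + X i) / 2, (hi + lo) / 2) w := by
  rintro _ ⟨t, ha, hb, rfl⟩
  rw [mem_stripCross, abs_le, abs_le]
  by_cases ht : t < i ∨ j < t
  · right
    have h3 := hlo.2 (mem_outerValues (Y := Y) ha hb ht)
    have h4 := hhi.2 (mem_outerValues (Y := Y) ha hb ht)
    constructor <;> dsimp only <;> linarith
  · left
    push Not at ht
    have h3 := hX i t hi' ht.1 hb
    have h4 := hX t j ha ht.2 hj'
    constructor <;> dsimp only <;> linarith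

/-- If positions `i, …, j` leave a large `y`-extent, then so do the positions `k, …, j` with
`i ≤ k`. -/
lemma Coverable.sub_le {k : ℕ} (hw : 0 ≤ w) (hm : ∀ t, a ≤ t → t < b → m ≤ Y t ∧ Y t ≤ M)
    (hmM : m ≤ M) (hi' : i ≤ b) (hj' : a ≤ j) (hik : i ≤ k)
    (hlo : IsLeast (outerValues Y a b i j M) lo) (hhi : IsGreatest (outerValues Y a b i j m) hi)
    (h : Coverable X Y a b k j w) : hi - lo ≤ w := by
  -- The defaults `M` for the minimum and `m` for the maximum stand in for infinities: whenever one
  -- of them is attained, the extent is at most zero.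
  rcases eq_or_of_mem_outerValues hi' hj' hlo.1 with h1 | ⟨t, h1, h2, h3, rfl⟩ <;>
    rcases eq_or_of_mem_outerValues hi' hj' hhi.1 with h4 | ⟨u, h4, h5, h6, rfl⟩
  · linarith
  · linarith [(hm u h4 h5).2]
  · linarith [(hm t h1 h2).1]
  · exact h.2 u t h4 h5 h1 h2 (by omega) (by omega)

/-- If positions `i, …, j` are far apart, then so are the positions `i, …, k` with `j ≤ k`. -/
lemma Coverable.sub_le' {k : ℕ} (hX : ∀ t u, a ≤ t → t ≤ u → u < b → X t ≤ X u)
    (hj' : a ≤ j) (hjk : j ≤ k) (hk : k < b) (h : Coverable X Y a b i k w) : X j - X i ≤ w := by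
  linarith [hX j k hj' hjk hk, h.1]

end

namespace RealRAM

/-! ### Reasoning about programs -/

/-- The program `P` started in memory `s` halts; the final memory and the number of steps
satisfy `Q`. -/
def Halts (P : Program) (s : State) (Q : State → ℕ → Prop) : Prop :=
  ∃ s' t, Exec P s s' t ∧ Q s' t

lemma Halts.mono {P : Program} {s : State} {Q R : State → ℕ → Prop} (h : Halts P s Q)
    (hQR : ∀ s' t, Q s' t → R s' t) : Halts P s R := by
  obtain ⟨s', t, he, hq⟩ := h
  exact ⟨s', t, he, hQR s' t hq⟩

lemma Halts.skip {s : State} {Q : State → ℕ → Prop} (h : Q s 1) : Halts .skip s Q :=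
  ⟨s, 1, .skip s, h⟩

lemma Halts.instr {c : Instr} {s : State} {Q : State → ℕ → Prop} (h : Q (c.eval s) 1) :
    Halts (.instr c) s Q := ⟨_, 1, .instr c s, h⟩

lemma Halts.seq {P P' : Program} {s : State} {Q : State → ℕ → Prop}
    (h : Halts P s fun s' t => Halts P' s' fun s'' t' => Q s'' (t + t')) :
    Halts (.seq P P') s Q := by
  obtain ⟨s', t, he, s'', t', he', hq⟩ := h
  exact ⟨s'', t + t', .seq he he', hq⟩

lemma Halts.cond {b : Test} {P P' : Program} {s : State} {Q : State → ℕ → Prop}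
    (h : b.Holds s → Halts P s fun s' t => Q s' (t + 1))
    (h' : ¬ b.Holds s → Halts P' s fun s' t => Q s' (t + 1)) : Halts (.cond b P P') s Q := by
  by_cases hb : b.Holds s
  · obtain ⟨s', t, he, hq⟩ := h hb
    exact ⟨s', t + 1, .condTrue hb he, hq⟩
  · obtain ⟨s', t, he, hq⟩ := h' hb
    exact ⟨s', t + 1, .condFalse hb he, hq⟩

/-- Loops: the invariant `I k` carries a budget `k` of steps. -/
lemma Halts.loop {b : Test} {P : Program} (I : ℕ → State → Prop)
    (hstep : ∀ k s, I k s → b.Holds s → Halts P s fun s' t => ∃ k', I k' s' ∧ k' + t + 1 ≤ k)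
    (k : ℕ) (s : State) (h : I k s) :
    Halts (.loop b P) s fun s' t => ∃ k', I k' s' ∧ ¬ b.Holds s' ∧ t + k' ≤ k + 1 := by
  induction k using Nat.strong_induction_on generalizing s with
  | _ k ih =>
    by_cases hb : b.Holds s
    · obtain ⟨s', t, he, k', hI, hk⟩ := hstep k s h hb
      obtain ⟨s'', t', he', k'', hI', hb', hk'⟩ := ih k' (by omega) s' hI
      exact ⟨s'', t + t' + 1, .loopTrue hb he he', k'', hI', hb', by omega⟩
    · exact ⟨s, 1, .loopFalse hb, k, h, hb, by omega⟩

/-- Straight-line programs. -/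
def block : List Instr → Program
  | [] => .skip
  | c :: l => .seq (.instr c) (block l)

lemma Halts.block {l : List Instr} {s : State} {Q : State → ℕ → Prop}
    (h : Q (l.foldl (fun s c => c.eval s) s) (l.length + 1)) : Halts (block l) s Q := by
  induction l generalizing s Q with
  | nil => exact Halts.skip h
  | cons c l ih =>
    refine Halts.seq (Halts.instr (ih ?_))
    rwa [Nat.add_comm 1]

/-- `reg x := min (reg x) (reg y)`, where `reg z = 0`. -/
def setMin (x y z : ℕ) : Program := .cond (.realLt y x) (.instr (.realOp .add x y z)) .skip

/-- `reg x := max (reg x) (reg y)`, where `reg z = 0`. -/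
def setMax (x y z : ℕ) : Program := .cond (.realLt x y) (.instr (.realOp .add x y z)) .skip

lemma Halts.setMin {x y z : ℕ} {s : State} {Q : State → ℕ → Prop} (hz : s.reg z = 0)
    (h : Q { s with reg := Function.update s.reg x (min (s.reg x) (s.reg y)) } 2) :
    Halts (setMin x y z) s Q := by
  refine Halts.cond (fun hb => Halts.instr ?_) fun hb => Halts.skip ?_
  · change s.reg y < s.reg x at hb
    simpa only [Instr.eval, RealOp.eval, hz, add_zero, min_eq_right hb.le] using h
  · change ¬ s.reg y < s.reg x at hb
    rw [min_eq_left (not_lt.1 hb), Function.update_eq_self] at h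
    exact h

lemma Halts.setMax {x y z : ℕ} {s : State} {Q : State → ℕ → Prop} (hz : s.reg z = 0)
    (h : Q { s with reg := Function.update s.reg x (max (s.reg x) (s.reg y)) } 2) :
    Halts (setMax x y z) s Q := by
  refine Halts.cond (fun hb => Halts.instr ?_) fun hb => Halts.skip ?_
  · change s.reg x < s.reg y at hb
    simpa only [Instr.eval, RealOp.eval, hz, add_zero, max_eq_right hb.le] using h
  · change ¬ s.reg x < s.reg y at hb
    rw [max_eq_left (not_lt.1 hb), Function.update_eq_self] at h
    exact h

/-! ### Padding the input to a power of two -/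

/-- Sets `idx 3` to the least power of two that is at least `n`, and `idx 1` to one. -/
def computeSize : Program :=
  .seq (block [.idxConst 1 1, .idxConst 3 1]) (.loop (.idxLt 3 0) (block [.idxAdd 3 3 3]))

lemma halts_computeSize {n : ℕ} (hn : 2 ≤ n) {s : State} (h0 : s.idx 0 = n) (h2 : s.idx 2 = 0) :
    Halts computeSize s fun s' t => s'.idx 0 = n ∧ s'.idx 1 = 1 ∧ s'.idx 2 = 0 ∧
      s'.rarr = s.rarr ∧ (∃ K, s'.idx 3 = 2 ^ K) ∧ n ≤ s'.idx 3 ∧ s'.idx 3 < 2 * n ∧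
      t ≤ 6 * n + 4 := by
  refine Halts.seq (Halts.block ?_)
  -- Doubling is charged only for an increase by one; this crude linear budget is enough here.
  refine (Halts.loop (fun k s' => s'.idx 0 = n ∧ s'.idx 1 = 1 ∧ s'.idx 2 = 0 ∧
    s'.rarr = s.rarr ∧ (∃ K, s'.idx 3 = 2 ^ K) ∧ s'.idx 3 < 2 * n ∧ 0 < s'.idx 3 ∧
    k = 3 * (2 * n - s'.idx 3)) ?_ (3 * (2 * n - 1)) _ ?_).mono ?_
  · rintro k s' ⟨e0, e1, e2, er, ⟨K, eK⟩, hlt, hpos, rfl⟩ hb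
    change s'.idx 3 < s'.idx 0 at hb
    refine Halts.block ⟨_, ⟨?_, ?_, ?_, ?_, ⟨K + 1, ?_⟩, ?_, ?_, rfl⟩, ?_⟩ <;>
      simp [Instr.eval, e0, e1, e2, er] <;> omega
  · simp [Instr.eval, h0, h2]
    exact ⟨⟨0, rfl⟩, by omega⟩
  · rintro s' t ⟨k, ⟨e0, e1, e2, er, eK, hlt, hpos, rfl⟩, hb, ht⟩
    change ¬ s'.idx 3 < s'.idx 0 at hb
    refine ⟨e0, e1, e2, er, eK, by omega, hlt, ?_⟩
    simp only [List.length_cons, List.length_nil]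
    omega

/-- Fills positions `n, …, N - 1` of the point arrays with copies of the first point. -/
def padPoints : Program :=
  .seq (block [.realLoad 2 0 2, .realLoad 3 1 2, .idxAdd 4 0 2])
    (.loop (.idxLt 4 3) (block [.realStore 0 4 2, .realStore 1 4 3, .idxAdd 4 4 1]))

lemma segmentPoints_succ (X Y : ℕ → ℝ) {a b : ℕ} (hab : a ≤ b) :
    segmentPoints X Y a (b + 1) = insert (X b, Y b) (segmentPoints X Y a b) := by
  ext z
  constructor
  · rintro ⟨t, h1, h2, rfl⟩
    rcases Nat.lt_succ_iff_lt_or_eq.1 h2 with h | rfl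
    · exact Or.inr ⟨t, h1, h, rfl⟩
    · exact Or.inl rfl
  · rintro (rfl | ⟨t, h1, h2, rfl⟩)
    · exact ⟨b, hab, Nat.lt_succ_self b, rfl⟩
    · exact ⟨t, h1, by omega, rfl⟩

lemma segmentPoints_congr {X Y X' Y' : ℕ → ℝ} {a b : ℕ}
    (h : ∀ t, a ≤ t → t < b → X t = X' t ∧ Y t = Y' t) :
    segmentPoints X Y a b = segmentPoints X' Y' a b := by
  ext z
  constructor
  · rintro ⟨t, h1, h2, rfl⟩
    exact ⟨t, h1, h2, by rw [(h t h1 h2).1, (h t h1 h2).2]⟩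
  · rintro ⟨t, h1, h2, rfl⟩
    exact ⟨t, h1, h2, by rw [(h t h1 h2).1, (h t h1 h2).2]⟩

/-- Each added point is a copy of a point already present, so the point set is unchanged; with `N` a
power of two, all blocks of the merge sort will be full. -/
lemma halts_padPoints {n N : ℕ} (hn : 0 < n) (hnN : n ≤ N) {s : State} (h0 : s.idx 0 = n)
    (h1 : s.idx 1 = 1) (h2 : s.idx 2 = 0) (h3 : s.idx 3 = N) :
    Halts padPoints s fun s' t => s'.idx 1 = 1 ∧ s'.idx 2 = 0 ∧ s'.idx 3 = N ∧
      segmentPoints (s'.rarr 0) (s'.rarr 1) 0 N = segmentPoints (s.rarr 0) (s.rarr 1) 0 n ∧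
      t ≤ 5 * N + 5 := by
  refine Halts.seq (Halts.block ?_)
  refine (Halts.loop (fun k s' => s'.idx 1 = 1 ∧ s'.idx 2 = 0 ∧ s'.idx 3 = N ∧ n ≤ s'.idx 4 ∧
    s'.idx 4 ≤ N ∧ s'.reg 2 = s.rarr 0 0 ∧ s'.reg 3 = s.rarr 1 0 ∧
    segmentPoints (s'.rarr 0) (s'.rarr 1) 0 (s'.idx 4) = segmentPoints (s.rarr 0) (s.rarr 1) 0 n ∧
    k = 5 * (N - s'.idx 4)) ?_ (5 * (N - n)) _ ?_).mono ?_
  · rintro k s' ⟨e1, e2, e3, hle, hle', er2, er3, hS, rfl⟩ hb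
    change s'.idx 4 < s'.idx 3 at hb
    refine Halts.block ⟨_, ⟨?_, ?_, ?_, ?_, ?_, ?_, ?_, ?_, rfl⟩, ?_⟩
    · simp [Instr.eval, e1]
    · simp [Instr.eval, e2]
    · simp [Instr.eval, e3]
    · simp [Instr.eval, e1]; omega
    · simp [Instr.eval, e1]; omega
    · simp [Instr.eval, er2]
    · simp [Instr.eval, er3]
    · simp [Instr.eval, e1, er2, er3]
      rw [segmentPoints_succ _ _ (Nat.zero_le _), ← hS]
      simp only [Function.update_self]
      rw [segmentPoints_congr (X' := s'.rarr 0) (Y' := s'.rarr 1)]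
      · refine Set.insert_eq_of_mem ?_
        rw [hS]
        exact ⟨0, le_rfl, hn, rfl⟩
      · intro t _ ht
        simp [ht.ne]
    · simp [Instr.eval, e1]; omega
  · simp [Instr.eval, h0, h1, h2, h3, hnN]
  · rintro s' t ⟨k, ⟨e1, e2, e3, hle, hle', er2, er3, hS, rfl⟩, hb, ht⟩
    change ¬ s'.idx 4 < s'.idx 3 at hb
    obtain rfl : s'.idx 4 = N := by omega
    refine ⟨e1, e2, e3, hS, ?_⟩
    simp only [List.length_cons, List.length_nil]
    omega

/-! ### Merge sort

The arrays `0` and `1` hold the points to be sorted at positions `B, …, B + N - 1`; a pass merges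
the sorted blocks of length `w` into blocks of length `2 * w` and writes them to the positions
`B + N, …, B + 2 * N - 1`. -/

/-- Each block of length `w` of `X B, …, X (B + N - 1)` is sorted. -/
def SortedBlocks (X : ℕ → ℝ) (B N w : ℕ) : Prop :=
  ∀ L r, w ∣ L → r + 1 < w → L + r + 1 < N → X (B + L + r) ≤ X (B + L + r + 1)

/-- State of a pass: `X`, `Y` are the arrays before the pass and `A`, `A'` the present arrays; the
blocks starting at `L` and `L + w` are being merged, with read positions `i` and `j` and write
position `d`. -/
structure Merging (X Y : ℕ → ℝ) (B N w L i j d : ℕ) (A A' : ℕ → ℝ) : Prop where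
  dvd : 2 * w ∣ L
  block_le : L + 2 * w ≤ N
  le_i : B + L ≤ i
  i_le : i ≤ B + L + w
  le_j : B + L + w ≤ j
  j_le : j ≤ B + L + 2 * w
  write_eq : d + (B + L + w) = i + j + N
  source : ∀ t, t < B + N → A t = X t ∧ A' t = Y t
  sub : ∀ t, B + N ≤ t → t < d → ∃ u, B ≤ u ∧ u < B + N ∧ A t = X u ∧ A' t = Y u
  cover : ∀ u, B ≤ u → (u < i ∨ B + L + w ≤ u ∧ u < j) →
    ∃ t, B + N ≤ t ∧ t < d ∧ A t = X u ∧ A' t = Y u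
  sorted : ∀ L' r, 2 * w ∣ L' → r + 1 < 2 * w → B + N + L' + r + 1 < d →
    A (B + N + L' + r) ≤ A (B + N + L' + r + 1)
  last : ∀ t, t + 1 = d → B + N + L ≤ t →
    (i < B + L + w → A t ≤ X i) ∧ (j < B + L + 2 * w → A t ≤ X j)

/-- Common part of taking from the left and from the right block: order with the previously written
value comes from `last`, and `h1`, `h2` restore `last` for the new one. -/
lemma Merging.take {X Y : ℕ → ℝ} {B N w L i j d : ℕ} {A A' : ℕ → ℝ}
    (h : Merging X Y B N w L i j d A A') {u i' j' : ℕ}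
    (hu : (u = i ∧ i' = i + 1 ∧ j' = j ∧ i < B + L + w) ∨
      (u = j ∧ i' = i ∧ j' = j + 1 ∧ j < B + L + 2 * w))
    (h1 : i' < B + L + w → X u ≤ X i') (h2 : j' < B + L + 2 * w → X u ≤ X j') :
    Merging X Y B N w L i' j' (d + 1) (Function.update A d (X u)) (Function.update A' d (Y u)) := by
  have b := h.block_le
  have bi := h.le_i
  have bi' := h.i_le
  have bj := h.le_j
  have bj' := h.j_le
  have bd := h.write_eq
  have hne : ∀ t, t ≠ d → Function.update A d (X u) t = A t ∧ Function.update A' d (Y u) t = A' t :=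
    fun t ht => ⟨Function.update_of_ne ht _ _, Function.update_of_ne ht _ _⟩
  have hself : Function.update A d (X u) d = X u ∧ Function.update A' d (Y u) d = Y u :=
    ⟨Function.update_self _ _ _, Function.update_self _ _ _⟩
  refine ⟨h.dvd, b, by omega, by omega, by omega, by omega, by omega, ?_, ?_, ?_, ?_, ?_⟩
  · intro t ht
    rw [(hne t (by omega)).1, (hne t (by omega)).2]
    exact h.source t ht
  · intro t ht1 ht2
    rcases Nat.lt_succ_iff_lt_or_eq.1 ht2 with ht | rfl
    · rw [(hne t (by omega)).1, (hne t (by omega)).2]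
      exact h.sub t ht1 ht
    · exact ⟨u, by omega, by omega, hself⟩
  · intro z hz hz'
    by_cases hzu : z = u
    · subst hzu
      exact ⟨d, by omega, by omega, hself⟩
    · obtain ⟨t, ht1, ht2, ht3⟩ := h.cover z hz (by omega)
      refine ⟨t, ht1, by omega, ?_⟩
      rwa [(hne t (by omega)).1, (hne t (by omega)).2]
  · intro L' r hL' hr hlt
    rcases Nat.lt_succ_iff_lt_or_eq.1 hlt with ht | ht
    · rw [(hne _ (by omega)).1, (hne _ ht.ne).1]
      exact h.sorted L' r hL' hr ht
    · rw [(hne (B + N + L' + r) (by omega)).1, ht, hself.1]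
      -- The previous position belongs to the pair being merged: otherwise `L' + (r + 1) = L`, and
      -- `2 * w` would divide `r + 1 < 2 * w`.
      have hge : B + N + L ≤ B + N + L' + r := by
        by_contra! hlt'
        have heq : L' + (r + 1) = L := by omega
        have hdvd := h.dvd
        rw [← heq] at hdvd
        have := Nat.le_of_dvd (Nat.succ_pos r) ((Nat.dvd_add_right hL').1 hdvd)
        omega
      have hl := h.last _ ht hge
      rcases hu with ⟨rfl, -, -, hlt'⟩ | ⟨rfl, -, -, hlt'⟩
      · exact hl.1 hlt'
      · exact hl.2 hlt'
  · intro t ht _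
    obtain rfl : t = d := by omega
    rw [hself.1]
    exact ⟨h1, h2⟩

lemma Merging.takeLeft {X Y : ℕ → ℝ} {B N w L i j d : ℕ} {A A' : ℕ → ℝ}
    (h : Merging X Y B N w L i j d A A') (hs : SortedBlocks X B N w) (hi : i < B + L + w)
    (hij : j < B + L + 2 * w → X i ≤ X j) :
    Merging X Y B N w L (i + 1) j (d + 1) (Function.update A d (X i))
      (Function.update A' d (Y i)) := by
  have b := h.block_le
  have bi := h.le_i
  refine h.take (Or.inl ⟨rfl, rfl, rfl, hi⟩) (fun hlt => ?_) hij
  have := hs L (i - (B + L)) ((Dvd.intro_left 2 rfl).trans h.dvd) (by omega) (by omega)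
  rwa [show B + L + (i - (B + L)) = i by omega] at this

lemma Merging.takeRight {X Y : ℕ → ℝ} {B N w L i j d : ℕ} {A A' : ℕ → ℝ}
    (h : Merging X Y B N w L i j d A A') (hs : SortedBlocks X B N w) (hj : j < B + L + 2 * w)
    (hij : i < B + L + w → X j ≤ X i) :
    Merging X Y B N w L i (j + 1) (d + 1) (Function.update A d (X j))
      (Function.update A' d (Y j)) := by
  have b := h.block_le
  have bj := h.le_j
  refine h.take (Or.inr ⟨rfl, rfl, rfl, hj⟩) hij (fun hlt => ?_)
  have := hs (L + w) (j - (B + L + w))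
    (Nat.dvd_add ((Dvd.intro_left 2 rfl).trans h.dvd) dvd_rfl) (by omega) (by omega)
  rwa [show B + (L + w) + (j - (B + L + w)) = j by omega] at this

/-- Since `2 * w` divides `N`, the output being incomplete means that another full pair of blocks
remains. -/
lemma Merging.next {X Y : ℕ → ℝ} {B N w L i j d : ℕ} {A A' : ℕ → ℝ}
    (h : Merging X Y B N w L i j d A A') (hN : 2 * w ∣ N) (hi : ¬ i < B + L + w)
    (hj : ¬ j < B + L + 2 * w) (hd : d < B + 2 * N) :
    Merging X Y B N w (L + 2 * w) (B + (L + 2 * w)) (B + (L + 2 * w) + w) d A A' := by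
  have b := h.block_le
  have bi := h.le_i
  have bi' := h.i_le
  have bj := h.le_j
  have bj' := h.j_le
  have bd := h.write_eq
  have hdvd : 2 * w ∣ L + 2 * w := Nat.dvd_add h.dvd dvd_rfl
  have hle : 2 * w ≤ N - (L + 2 * w) := Nat.le_of_dvd (by omega) (Nat.dvd_sub hN hdvd)
  refine ⟨hdvd, by omega, by omega, by omega, by omega, by omega, by omega, h.source, h.sub, ?_,
    h.sorted, ?_⟩
  · intro u hu hu'
    exact h.cover u hu (by omega)
  · intro t ht ht'
    omega

/-- Copies the point at position `idx k` to position `idx 11` and advances both. -/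
def takePoint (k : ℕ) : Program :=
  block [.realLoad 2 0 k, .realLoad 3 1 k, .realStore 0 11 2, .realStore 1 11 3, .idxAdd k k 1,
    .idxAdd 11 11 1]

/-- Advances to the next pair of blocks. -/
def nextBlocks : Program :=
  block [.idxAdd 7 10 2, .idxAdd 8 7 5, .idxAdd 9 7 5, .idxAdd 10 8 5]

def mergeStep : Program :=
  .cond (.idxLt 7 8)
    (.cond (.idxLt 9 10)
      (.seq (block [.realLoad 2 0 7, .realLoad 3 0 9])
        (.cond (.realLt 3 2) (takePoint 9) (takePoint 7)))
      (takePoint 7))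
    (.cond (.idxLt 9 10) (takePoint 9) nextBlocks)

/-- One pass of merge sort. -/
def mergePass : Program :=
  .seq (block [.idxAdd 7 6 2, .idxAdd 8 7 5, .idxAdd 9 7 5, .idxAdd 10 8 5, .idxAdd 11 6 3,
    .idxAdd 12 11 3]) (.loop (.idxLt 11 12) mergeStep)

/-- The registers that do not change during a pass. -/
def PassRegs (w B N : ℕ) (s : State) : Prop :=
  s.idx 1 = 1 ∧ s.idx 2 = 0 ∧ s.idx 3 = N ∧ s.idx 5 = w ∧ s.idx 6 = B

/-- Invariant of a pass. -/
def PassInv (X Y : ℕ → ℝ) (w B N k : ℕ) (s : State) : Prop :=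
  PassRegs w B N s ∧ s.idx 12 = B + 2 * N ∧ ∃ L, s.idx 8 = B + L + w ∧ s.idx 10 = B + L + 2 * w ∧
    Merging X Y B N w L (s.idx 7) (s.idx 9) (s.idx 11) (s.rarr 0) (s.rarr 1) ∧
    k = 20 * (B + 2 * N - s.idx 11) + 20 * (B + N - s.idx 10)

/-- The budget has two terms because moving to the next pair writes nothing: it is paid for by the
advance of the block end `idx 10`, all other steps by the advance of `idx 11`. -/
lemma halts_mergeStep {X Y : ℕ → ℝ} {w B N k : ℕ} {s : State} (hs : SortedBlocks X B N w)
    (hw : 0 < w) (hN : 2 * w ∣ N) (h : PassInv X Y w B N k s) (hlt : s.idx 11 < s.idx 12) :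
    Halts mergeStep s fun s' t => ∃ k', PassInv X Y w B N k' s' ∧ k' + t + 1 ≤ k := by
  obtain ⟨⟨e1, e2, e3, e5, e6⟩, e12, L, e8, e10, hm, rfl⟩ := h
  have b := hm.block_le
  have bi' := hm.i_le
  have bj' := hm.j_le
  have bd := hm.write_eq
  have left : ∀ {s' : State}, s'.idx = s.idx → s'.rarr = s.rarr → s.idx 7 < s.idx 8 →
      (s.idx 9 < s.idx 10 → X (s.idx 7) ≤ X (s.idx 9)) →
      Halts (takePoint 7) s' fun s' t => t ≤ 7 ∧ ∃ k', PassInv X Y w B N k' s' ∧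
        k' + 20 ≤ 20 * (B + 2 * N - s.idx 11) + 20 * (B + N - s.idx 10) := by
    intro s' hi hr h7 hle
    have hsrc := hm.source (s.idx 7) (by omega)
    refine Halts.block ⟨by simp, _, ⟨?_, ?_, L, ?_, ?_, ?_, rfl⟩, ?_⟩
    · simp [PassRegs, Instr.eval, hi, e1, e2, e3, e5, e6]
    · simp [Instr.eval, hi, e12]
    · simp [Instr.eval, hi, e8]
    · simp [Instr.eval, hi, e10]
    · have := hm.takeLeft hs (by omega) (fun h => hle (by omega))
      simpa [Instr.eval, hi, hr, e1, hsrc.1, hsrc.2] using this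
    · simp [Instr.eval, hi, e1, e10]
      omega
  have right : ∀ {s' : State}, s'.idx = s.idx → s'.rarr = s.rarr → s.idx 9 < s.idx 10 →
      (s.idx 7 < s.idx 8 → X (s.idx 9) ≤ X (s.idx 7)) →
      Halts (takePoint 9) s' fun s' t => t ≤ 7 ∧ ∃ k', PassInv X Y w B N k' s' ∧
        k' + 20 ≤ 20 * (B + 2 * N - s.idx 11) + 20 * (B + N - s.idx 10) := by
    intro s' hi hr h9 hle
    have hsrc := hm.source (s.idx 9) (by omega)
    refine Halts.block ⟨by simp, _, ⟨?_, ?_, L, ?_, ?_, ?_, rfl⟩, ?_⟩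
    · simp [PassRegs, Instr.eval, hi, e1, e2, e3, e5, e6]
    · simp [Instr.eval, hi, e12]
    · simp [Instr.eval, hi, e8]
    · simp [Instr.eval, hi, e10]
    · have := hm.takeRight hs (by omega) (fun h => hle (by omega))
      simpa [Instr.eval, hi, hr, e1, hsrc.1, hsrc.2] using this
    · simp [Instr.eval, hi, e1, e10]
      omega
  refine Halts.cond (fun h7 => Halts.cond (fun h9 => Halts.seq (Halts.block ?_)) fun h9 => ?_)
    fun h7 => Halts.cond (fun h9 => ?_) fun h9 => Halts.block ?_ <;>
    simp only [Test.Holds] at h7 h9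
  · have hsrc := hm.source (s.idx 7) (by omega)
    have hsrc' := hm.source (s.idx 9) (by omega)
    refine Halts.cond (fun hb => ?_) fun hb => ?_
    · refine (right (s' := List.foldl (fun s (c : Instr) => c.eval s) s _) rfl rfl h9 fun _ => ?_).mono ?_
      · simp [Test.Holds, Instr.eval, hsrc.1, hsrc'.1] at hb
        exact hb.le
      · rintro s' t ⟨ht, k', hI, hk⟩
        exact ⟨k', hI, by simp only [List.length_cons, List.length_nil]; omega⟩
    · refine (left (s' := List.foldl (fun s (c : Instr) => c.eval s) s _) rfl rfl h7 fun _ => ?_).mono ?_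
      · simpa [Test.Holds, Instr.eval, hsrc.1, hsrc'.1] using hb
      · rintro s' t ⟨ht, k', hI, hk⟩
        exact ⟨k', hI, by simp only [List.length_cons, List.length_nil]; omega⟩
  · refine (left rfl rfl h7 fun h => absurd h h9).mono ?_
    rintro s' t ⟨ht, k', hI, hk⟩
    exact ⟨k', hI, by omega⟩
  · refine (right rfl rfl h9 fun h => absurd h h7).mono ?_
    rintro s' t ⟨ht, k', hI, hk⟩
    exact ⟨k', hI, by omega⟩
  · have hn := hm.next hN (by omega) (by omega) (by omega)
    have b' := hn.block_le
    refine ⟨_, ⟨?_, ?_, L + 2 * w, ?_, ?_, ?_, rfl⟩, ?_⟩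
    · simp [PassRegs, Instr.eval, e1, e2, e3, e5, e6]
    · simp [Instr.eval, e12]
    · simp [Instr.eval, e10, e2, e5]
      omega
    · simp [Instr.eval, e10, e2, e5]
      omega
    · simpa [Instr.eval, e10, e2, e5, add_assoc] using hn
    · simp [Instr.eval, e10, e2, e5]
      omega

lemma halts_mergePass {w B N : ℕ} {s : State} (hr : PassRegs w B N s) (hw : 0 < w)
    (hN : 2 * w ∣ N) (hN0 : 0 < N) (hs : SortedBlocks (s.rarr 0) B N w) :
    Halts mergePass s fun s' t => PassRegs w B N s' ∧ SortedBlocks (s'.rarr 0) (B + N) N (2 * w) ∧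
      segmentPoints (s'.rarr 0) (s'.rarr 1) (B + N) (B + N + N) =
        segmentPoints (s.rarr 0) (s.rarr 1) B (B + N) ∧ t ≤ 40 * N + 8 := by
  have hr' := hr
  obtain ⟨e1, e2, e3, e5, e6⟩ := hr'
  have hle := Nat.le_of_dvd hN0 hN
  refine Halts.seq (Halts.block ?_)
  refine (Halts.loop (PassInv (s.rarr 0) (s.rarr 1) w B N)
    (fun k s' h hlt => halts_mergeStep hs hw hN h (by simpa only [Test.Holds] using hlt))
    (20 * (B + 2 * N - (B + N)) + 20 * (B + N - (B + 2 * w))) _ ?_).mono ?_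
  · refine ⟨?_, ?_, 0, ?_, ?_, ?_, ?_⟩
    · simpa [PassRegs, Instr.eval] using hr
    · simp [Instr.eval, e6, e3]
      omega
    · simp [Instr.eval, e6, e5, e2]
    · simp [Instr.eval, e6, e5, e2]
      omega
    · simp [Instr.eval, e6, e5, e2, e3]
      refine ⟨dvd_zero _, by omega, by omega, by omega, by omega, by omega, by omega,
        fun _ _ => ⟨rfl, rfl⟩, ?_, ?_, ?_, ?_⟩ <;> intros <;> omega
    · simp [Instr.eval, e6, e5, e2, e3]
      omega
  · rintro s' t ⟨k, ⟨hregs, e12, L, e8, e10, hm, rfl⟩, hlt, ht⟩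
    simp only [Test.Holds] at hlt
    have b := hm.block_le
    have bi' := hm.i_le
    have bj' := hm.j_le
    have bd := hm.write_eq
    refine ⟨hregs, fun L' r hL' hrw hlt' => hm.sorted L' r hL' hrw (by omega), ?_, ?_⟩
    · ext z
      constructor
      · rintro ⟨u, hu1, hu2, rfl⟩
        obtain ⟨u', hu1', hu2', h1, h2⟩ := hm.sub u hu1 (by omega)
        exact ⟨u', hu1', hu2', by rw [h1, h2]⟩
      · rintro ⟨u, hu1, hu2, rfl⟩
        obtain ⟨u', hu1', hu2', h1, h2⟩ := hm.cover u hu1 (by omega)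
        exact ⟨u', hu1', by omega, by rw [h1, h2]⟩
    · simp only [List.length_cons, List.length_nil]
      omega

/-- Sorts the points by their `x`-coordinates; the result starts at position `idx 6`. -/
def mergeSort : Program :=
  .seq (block [.idxConst 5 1, .idxConst 6 0])
    (.loop (.idxLt 5 3) (.seq mergePass (block [.idxAdd 5 5 5, .idxAdd 6 6 3])))

/-- Each of the `K` passes doubles the block length and moves the base by `N`, so nothing is copied
back. Blocks of length one are vacuously sorted. -/
lemma halts_mergeSort {K N : ℕ} (hN : N = 2 ^ K) {s : State} (h1 : s.idx 1 = 1)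
    (h2 : s.idx 2 = 0) (h3 : s.idx 3 = N) :
    Halts mergeSort s fun s' t => s'.idx 1 = 1 ∧ s'.idx 2 = 0 ∧ s'.idx 3 = N ∧
      SortedBlocks (s'.rarr 0) (s'.idx 6) N N ∧
      segmentPoints (s'.rarr 0) (s'.rarr 1) (s'.idx 6) (s'.idx 6 + N) =
        segmentPoints (s.rarr 0) (s.rarr 1) 0 N ∧ t ≤ K * (40 * N + 12) + 4 := by
  have hN0 : 0 < N := hN ▸ Nat.two_pow_pos K
  refine Halts.seq (Halts.block ?_)
  refine (Halts.loop (fun k s' => ∃ e B, e ≤ K ∧ PassRegs (2 ^ e) B N s' ∧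
    SortedBlocks (s'.rarr 0) B N (2 ^ e) ∧
    segmentPoints (s'.rarr 0) (s'.rarr 1) B (B + N) = segmentPoints (s.rarr 0) (s.rarr 1) 0 N ∧
    k = (K - e) * (40 * N + 12)) ?_ (K * (40 * N + 12)) _ ?_).mono ?_
  · rintro k s' ⟨e, B, he, hregs, hsort, hS, rfl⟩ hb
    simp only [Test.Holds, hregs.2.2.2.1, hregs.2.2.1] at hb
    have heK : e < K := by
      by_contra! hge
      have := Nat.pow_le_pow_right (show 0 < 2 by norm_num) hge
      omega
    have hdvd : 2 * 2 ^ e ∣ N := by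
      rw [hN, ← pow_succ']
      exact pow_dvd_pow 2 heK
    refine Halts.seq ((halts_mergePass hregs (Nat.two_pow_pos e) hdvd hN0 hsort).mono ?_)
    rintro s'' t ⟨⟨e1, e2, e3, e5, e6⟩, hsort', hS', ht⟩
    refine Halts.block ⟨_, ⟨e + 1, B + N, heK, ?_, ?_, ?_, rfl⟩, ?_⟩
    · simp [PassRegs, Instr.eval, e1, e2, e3, e5, e6, pow_succ']
      omega
    · simpa [Instr.eval, pow_succ'] using hsort'
    · simpa [Instr.eval] using hS'.trans hS
    · obtain ⟨m, hm⟩ : ∃ m, K - e = m + 1 := ⟨K - e - 1, by omega⟩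
      rw [hm, show K - (e + 1) = m by omega, add_one_mul m]
      simp only [List.length_cons, List.length_nil]
      omega
  · refine ⟨0, 0, Nat.zero_le _, ?_, ?_, ?_, rfl⟩
    · simp [PassRegs, Instr.eval, h1, h2, h3]
    · intro L r _ hr
      omega
    · simp [Instr.eval]
  · rintro s' t ⟨k, ⟨e, B, he, ⟨e1, e2, e3, e5, e6⟩, hsort, hS, rfl⟩, hb, ht⟩
    simp only [Test.Holds, e5, e3] at hb
    have hle : 2 ^ e ≤ N := hN ▸ Nat.pow_le_pow_right (by norm_num) he
    obtain heN : 2 ^ e = N := by omega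
    rw [heN] at hsort
    rw [e6]
    refine ⟨e1, e2, e3, hsort, hS, ?_⟩
    simp only [List.length_cons, List.length_nil]
    omega

lemma SortedBlocks.le {X : ℕ → ℝ} {B N : ℕ} (h : SortedBlocks X B N N) {t u : ℕ} (ht : B ≤ t)
    (htu : t ≤ u) (hu : u < B + N) : X t ≤ X u := by
  induction u, htu using Nat.le_induction with
  | base => exact le_rfl
  | succ u htu ih =>
    refine (ih (by omega)).trans ?_
    have := h 0 (u - B) (dvd_zero _) (by omega) (by omega)
    rwa [show B + 0 + (u - B) = u by omega] at this

/-! ### Suffix extrema -/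

/-- Computes the minima and maxima of the suffixes of the `y`-coordinates in the arrays `2` and
`3`; behind the last position, the maximum and the minimum of all values are stored. -/
def suffixExtrema : Program :=
  .seq (block [.realConst 9 0, .idxAdd 13 6 3, .idxSub 13 13 1, .realLoad 4 1 13, .realLoad 5 1 13,
    .realStore 2 13 4, .realStore 3 13 5])
    (.seq (.loop (.idxLt 6 13) (.seq (block [.idxSub 13 13 1, .realLoad 6 1 13])
      (.seq (setMin 4 6 9) (.seq (setMax 5 6 9) (block [.realStore 2 13 4, .realStore 3 13 5])))))
      (block [.idxAdd 13 6 3, .realStore 2 13 5, .realStore 3 13 4]))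

lemma Ico_eq_insert {a b : ℕ} (h : a < b) : Set.Ico a b = insert a (Set.Ico (a + 1) b) := by
  ext t
  simp only [Set.mem_Ico, Set.mem_insert_iff]
  omega

/-- The overall maximum in the array of minima, and the overall minimum in the array of maxima,
represent the empty suffix at `B + N` and are neutral for later minima and maxima. -/
lemma halts_suffixExtrema {B N : ℕ} (hN : 0 < N) {s : State} (h1 : s.idx 1 = 1)
    (h2 : s.idx 2 = 0) (h3 : s.idx 3 = N) (h6 : s.idx 6 = B) :
    Halts suffixExtrema s fun s' t => s'.idx 1 = 1 ∧ s'.idx 2 = 0 ∧ s'.idx 3 = N ∧ s'.idx 6 = B ∧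
      s'.reg 9 = 0 ∧ s'.rarr 0 = s.rarr 0 ∧ s'.rarr 1 = s.rarr 1 ∧
      IsLeast (s.rarr 1 '' Set.Ico B (B + N)) (s'.reg 4) ∧
      IsGreatest (s.rarr 1 '' Set.Ico B (B + N)) (s'.reg 5) ∧
      (∀ z, B ≤ z → z < B + N → IsLeast (s.rarr 1 '' Set.Ico z (B + N)) (s'.rarr 2 z) ∧
        IsGreatest (s.rarr 1 '' Set.Ico z (B + N)) (s'.rarr 3 z)) ∧
      s'.rarr 2 (B + N) = s'.reg 5 ∧ s'.rarr 3 (B + N) = s'.reg 4 ∧ t ≤ 12 * N + 13 := by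
  refine Halts.seq (Halts.block (Halts.seq ?_))
  refine (Halts.loop (fun k s' => s'.idx 1 = 1 ∧ s'.idx 2 = 0 ∧ s'.idx 3 = N ∧ s'.idx 6 = B ∧
    s'.reg 9 = 0 ∧ s'.rarr 0 = s.rarr 0 ∧ s'.rarr 1 = s.rarr 1 ∧
    B ≤ s'.idx 13 ∧ s'.idx 13 < B + N ∧
    IsLeast (s.rarr 1 '' Set.Ico (s'.idx 13) (B + N)) (s'.reg 4) ∧
    IsGreatest (s.rarr 1 '' Set.Ico (s'.idx 13) (B + N)) (s'.reg 5) ∧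
    (∀ z, s'.idx 13 ≤ z → z < B + N → IsLeast (s.rarr 1 '' Set.Ico z (B + N)) (s'.rarr 2 z) ∧
      IsGreatest (s.rarr 1 '' Set.Ico z (B + N)) (s'.rarr 3 z)) ∧
    k = 12 * (s'.idx 13 - B)) ?_ (12 * (N - 1)) _ ?_).mono ?_
  · rintro k s' ⟨e1, e2, e3, e6, e9, r0, r1, hle, hlt, hmin, hmax, hsuf, rfl⟩ hb
    simp only [Test.Holds, e6] at hb
    obtain ⟨z, hz⟩ : ∃ z, s'.idx 13 = z + 1 := ⟨s'.idx 13 - 1, by omega⟩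
    rw [hz] at hle hlt hmin hmax hsuf hb
    refine Halts.seq (Halts.block (Halts.seq (Halts.setMin (by simpa [Instr.eval] using e9)
      (Halts.seq (Halts.setMax (by simpa [Instr.eval] using e9) (Halts.block ?_))))))
    have hmin' : IsLeast (s.rarr 1 '' Set.Ico z (B + N)) (min (s'.reg 4) (s.rarr 1 z)) := by
      rw [Ico_eq_insert (by omega), Set.image_insert_eq, min_comm]
      exact hmin.insert _
    have hmax' : IsGreatest (s.rarr 1 '' Set.Ico z (B + N)) (max (s'.reg 5) (s.rarr 1 z)) := by
      rw [Ico_eq_insert (by omega), Set.image_insert_eq, max_comm]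
      exact hmax.insert _
    refine ⟨_, ⟨?_, ?_, ?_, ?_, ?_, ?_, ?_, ?_, ?_, ?_, ?_, ?_, rfl⟩, ?_⟩
    · simp [Instr.eval, e1]
    · simp [Instr.eval, e2]
    · simp [Instr.eval, e3]
    · simp [Instr.eval, e6]
    · simp [Instr.eval, e9]
    · simp [Instr.eval, r0]
    · simp [Instr.eval, r1]
    · simp [Instr.eval, e1, hz]; omega
    · simp [Instr.eval, e1, hz]; omega
    · simpa [Instr.eval, e1, hz, r1] using hmin'
    · simpa [Instr.eval, e1, hz, r1] using hmax'
    · intro y hy hy'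
      by_cases hyz : y = z
      · subst hyz
        simpa [Instr.eval, e1, hz, r1] using And.intro hmin' hmax'
      · simp [Instr.eval, e1, hz] at hy
        simpa [Instr.eval, e1, hz, hyz] using hsuf y (by omega) hy'
    · simp [Instr.eval, e1, hz]
      omega
  · have hsing : Set.Ico (B + N - 1) (B + N) = {B + N - 1} := by
      ext t
      simp only [Set.mem_Ico, Set.mem_singleton_iff]
      omega
    simp [Instr.eval, h1, h2, h3, h6, hsing]
    refine ⟨by omega, by omega, ?_, by omega⟩
    intro z hz hz'
    obtain rfl : z = B + N - 1 := by omega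
    simp [hsing]
  · rintro s' t ⟨k, ⟨e1, e2, e3, e6, e9, r0, r1, hle, hlt, hmin, hmax, hsuf, rfl⟩, hb, ht⟩
    simp only [Test.Holds, e6] at hb
    have hz : s'.idx 13 = B := by omega
    rw [hz] at hmin hmax hsuf
    refine Halts.block ⟨?_, ?_, ?_, ?_, ?_, ?_, ?_, ?_, ?_, ?_, ?_, ?_, ?_⟩
    · simp [Instr.eval, e1]
    · simp [Instr.eval, e2]
    · simp [Instr.eval, e3]
    · simp [Instr.eval, e6]
    · simp [Instr.eval, e9]
    · simp [Instr.eval, r0]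
    · simp [Instr.eval, r1]
    · simpa [Instr.eval] using hmin
    · simpa [Instr.eval] using hmax
    · intro y hy hy'
      have := hsuf y hy hy'
      simpa [Instr.eval, e6, e3, hy'.ne] using this
    · simp [Instr.eval, e6, e3]
    · simp [Instr.eval, e6, e3]
    · simp only [List.length_cons, List.length_nil]
      omega

/-! ### The sweep -/

/-- Evaluates the cross whose vertical strip covers the positions `idx 14, …, idx 15`. -/
def evalStrip : Program :=
  .seq (block [.realLoad 13 0 14, .realLoad 14 0 15, .realOp .sub 15 14 13, .realOp .add 16 14 13,
    .realLoad 17 2 17, .realLoad 18 3 17])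
    (.seq (setMin 17 7 9) (.seq (setMax 18 8 9)
      (.seq (block [.realOp .sub 19 18 17, .realOp .add 20 18 17, .realOp .add 22 15 9])
        (setMax 22 19 9))))

/-- Remembers the present cross if it is the best so far. -/
def keepBest : Program :=
  .cond (.realLt 22 10) (block [.realOp .add 10 22 9, .realOp .add 11 16 9, .realOp .add 12 20 9])
    .skip

/-- Advances the right or the left end of the vertical strip. -/
def advance : Program :=
  .cond (.realLt 15 19)
    (.seq (block [.idxAdd 15 15 1, .idxAdd 17 17 1]) (.cond (.idxLt 15 16) .skip
      (.instr (.idxAdd 14 16 2))))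
    (.seq (block [.realLoad 21 1 14]) (.seq (setMin 7 21 9) (.seq (setMax 8 21 9)
      (block [.idxAdd 14 14 1]))))

/-- Finds a smallest enclosing cross. -/
def sweep : Program :=
  .seq (block [.idxAdd 14 6 2, .idxAdd 15 6 2, .idxAdd 16 6 3, .idxAdd 17 15 1,
    .realOp .add 7 5 9, .realOp .add 8 4 9, .realOp .sub 10 5 4, .realConst 11 0,
    .realOp .add 12 5 4])
    (.seq (.loop (.idxLt 14 16) (.seq evalStrip (.seq keepBest advance)))
      (block [.realConst 2 (1 / 2), .realOp .mul 0 11 2, .realOp .mul 1 12 2]))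

lemma halts_evalStrip {s : State} (h9 : s.reg 9 = 0) :
    Halts evalStrip s fun s' t => t = 17 ∧ s'.idx = s.idx ∧ s'.rarr = s.rarr ∧
      (∀ x, (7 ≤ x ∧ x ≤ 12) → s'.reg x = s.reg x) ∧
      s'.reg 15 = s.rarr 0 (s.idx 15) - s.rarr 0 (s.idx 14) ∧
      s'.reg 16 = s.rarr 0 (s.idx 15) + s.rarr 0 (s.idx 14) ∧
      s'.reg 19 = max (s.rarr 3 (s.idx 17)) (s.reg 8) - min (s.rarr 2 (s.idx 17)) (s.reg 7) ∧
      s'.reg 20 = max (s.rarr 3 (s.idx 17)) (s.reg 8) + min (s.rarr 2 (s.idx 17)) (s.reg 7) ∧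
      s'.reg 22 = max (s'.reg 15) (s'.reg 19) := by
  refine Halts.seq (Halts.block (Halts.seq (Halts.setMin (by simpa [Instr.eval] using h9)
    (Halts.seq (Halts.setMax (by simpa [Instr.eval] using h9) (Halts.seq (Halts.block
      (Halts.setMax (by simpa [Instr.eval] using h9) ?_))))))))
  refine ⟨rfl, ?_, ?_, ?_, ?_, ?_, ?_, ?_, ?_⟩
  · simp [Instr.eval]
  · simp [Instr.eval]
  · rintro x ⟨hx, hx'⟩
    interval_cases x <;> simp [Instr.eval]
  · simp [Instr.eval, RealOp.eval]
  · simp [Instr.eval, RealOp.eval]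
  · simp [Instr.eval, RealOp.eval]
  · simp [Instr.eval, RealOp.eval]
  · simp [Instr.eval, RealOp.eval, h9]

lemma halts_keepBest {s : State} (h9 : s.reg 9 = 0) :
    Halts keepBest s fun s' t => t ≤ 5 ∧ s'.idx = s.idx ∧ s'.rarr = s.rarr ∧
      s'.reg 7 = s.reg 7 ∧ s'.reg 8 = s.reg 8 ∧ s'.reg 9 = 0 ∧ s'.reg 15 = s.reg 15 ∧
      s'.reg 19 = s.reg 19 ∧ s'.reg 10 ≤ s.reg 10 ∧ s'.reg 10 ≤ s.reg 22 ∧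
      ((s'.reg 10 = s.reg 22 ∧ s'.reg 11 = s.reg 16 ∧ s'.reg 12 = s.reg 20) ∨
        (s'.reg 10 = s.reg 10 ∧ s'.reg 11 = s.reg 11 ∧ s'.reg 12 = s.reg 12)) := by
  refine Halts.cond (fun hb => Halts.block ?_) fun hb => Halts.skip ?_ <;>
    simp only [Test.Holds] at hb
  · simp [Instr.eval, RealOp.eval, h9, hb.le]
  · simp [h9, not_lt.1 hb]

/-- Invariant of the sweep: every cross whose vertical strip starts before position `idx 14` or
ends before position `idx 15` is at least as wide as the best cross found so far. -/
structure SweepInv (X Y : ℕ → ℝ) (a b : ℕ) (m M : ℝ) (k : ℕ) (s : State) : Prop where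
  one : s.idx 1 = 1
  zero : s.idx 2 = 0
  finish : s.idx 16 = b
  rzero : s.reg 9 = 0
  arr0 : s.rarr 0 = X
  arr1 : s.rarr 1 = Y
  suffix : ∀ z, a < z → z ≤ b → IsLeast (insert M (Y '' Set.Ico z b)) (s.rarr 2 z) ∧
    IsGreatest (insert m (Y '' Set.Ico z b)) (s.rarr 3 z)
  succ : s.idx 17 = s.idx 15 + 1
  le_i : a ≤ s.idx 14
  i_le : s.idx 14 ≤ b
  le_j : a ≤ s.idx 15
  j_le : s.idx 15 ≤ b
  j_lt : s.idx 14 < b → s.idx 15 < b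
  pref : s.idx 14 < b → IsLeast (insert M (Y '' Set.Ico a (s.idx 14))) (s.reg 7) ∧
    IsGreatest (insert m (Y '' Set.Ico a (s.idx 14))) (s.reg 8)
  encl : segmentPoints X Y a b ⊆ stripCross (s.reg 11 / 2, s.reg 12 / 2) (s.reg 10)
  best : ∀ w i j, 0 ≤ w → a ≤ i → i < b → a ≤ j → j < b → (i < s.idx 14 ∨ j < s.idx 15) →
    Coverable X Y a b i j w → s.reg 10 ≤ w
  budget : 50 * (b - s.idx 14) + 50 * (b - s.idx 15) ≤ k

lemma Ico_succ_eq_insert {a b : ℕ} (h : a ≤ b) : Set.Ico a (b + 1) = insert b (Set.Ico a b) := by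
  ext t
  simp only [Set.mem_Ico, Set.mem_insert_iff]
  omega

/-- The width at ends `i, j` is the larger of the two extents. Moving `i` right cannot reduce the
`y`-extent left over, and moving `j` right cannot reduce the `x`-extent, so the dominating extent
tells which end is finished. -/
lemma halts_sweepStep {X Y : ℕ → ℝ} {a b k : ℕ} {m M : ℝ} {s : State}
    (hX : ∀ t u, a ≤ t → t ≤ u → u < b → X t ≤ X u)
    (hY : ∀ t, a ≤ t → t < b → m ≤ Y t ∧ Y t ≤ M) (hmM : m ≤ M)
    (h : SweepInv X Y a b m M k s) (hlt : s.idx 14 < b) :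
    Halts (.seq evalStrip (.seq keepBest advance)) s
      fun s' t => ∃ k', SweepInv X Y a b m M k' s' ∧ k' + t + 1 ≤ k := by
  have hj := h.j_lt hlt
  have hbud := h.budget
  refine Halts.seq ((halts_evalStrip h.rzero).mono ?_)
  rintro s₁ t₁ ⟨rfl, i₁, r₁, g₁, g15, g16, g19, g20, g22⟩
  refine Halts.seq ((halts_keepBest ((g₁ 9 (by omega)).trans h.rzero)).mono ?_)
  rintro s₂ t₂ ⟨ht₂, i₂, r₂, g7, g8, g9, g15', g19', gle, gle', gbest⟩
  rw [i₁] at i₂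
  rw [r₁] at r₂
  rw [g₁ 7 (by omega)] at g7
  rw [g₁ 8 (by omega)] at g8
  rw [g₁ 10 (by omega), g₁ 11 (by omega), g₁ 12 (by omega)] at gbest
  rw [g₁ 10 (by omega)] at gle
  rw [g22] at gle' gbest
  rw [← g15', ← g19'] at gle' gbest
  rw [g16, g20] at gbest
  rw [g15, h.arr0] at g15'
  rw [g19] at g19'
  rw [h.arr0] at gbest
  obtain ⟨hsl, hsg⟩ := h.suffix (s.idx 17) (by have := h.succ; have := h.le_j; omega)
    (by have := h.succ; omega)
  obtain ⟨hpl, hpg⟩ := h.pref hlt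
  have hlo : IsLeast (outerValues Y a b (s.idx 14) (s.idx 15) M)
      (min (s.rarr 2 (s.idx 17)) (s.reg 7)) := by
    rw [min_comm, outerValues, ← h.succ]
    exact hpl.union hsl
  have hhi : IsGreatest (outerValues Y a b (s.idx 14) (s.idx 15) m)
      (max (s.rarr 3 (s.idx 17)) (s.reg 8)) := by
    rw [max_comm, outerValues, ← h.succ]
    exact hpg.union hsg
  have hencl : segmentPoints X Y a b ⊆ stripCross (s₂.reg 11 / 2, s₂.reg 12 / 2) (s₂.reg 10) := by
    rcases gbest with ⟨q1, q2, q3⟩ | ⟨q1, q2, q3⟩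
    · rw [q1, q2, q3]
      refine segmentPoints_subset_stripCross hX h.le_i hj hlo hhi ?_ ?_
      · rw [g15']; exact le_max_left _ _
      · rw [g19']; exact le_max_right _ _
    · rw [q1, q2, q3]
      exact h.encl
  have hbest : ∀ w i j, 0 ≤ w → a ≤ i → i < b → a ≤ j → j < b →
      (i < s.idx 14 ∨ j < s.idx 15) → Coverable X Y a b i j w → s₂.reg 10 ≤ w :=
    fun w i j hw h1 h2 h3 h4 h5 hc => gle.trans (h.best w i j hw h1 h2 h3 h4 h5 hc)
  have hli := h.le_i
  have hlj := h.le_j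
  have hsucc := h.succ
  refine Halts.cond (fun hb => ?_) fun hb => ?_ <;> simp only [Test.Holds] at hb
  · rw [max_eq_right hb.le] at gle'
    -- The `y`-extent dominates: no later left end improves on the present cross with this right
    -- end, so the right end may advance.
    have hcol : ∀ w i, 0 ≤ w → s.idx 14 ≤ i → Coverable X Y a b i (s.idx 15) w →
        s₂.reg 10 ≤ w := by
      intro w i hw hi hc
      rw [g19'] at gle'
      exact gle'.trans (hc.sub_le hw hY hmM h.i_le h.le_j hi hlo hhi)
    have hbest' : ∀ w i j, 0 ≤ w → a ≤ i → i < b → a ≤ j → j < b →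
        (i < s.idx 14 ∨ j < s.idx 15 + 1) → Coverable X Y a b i j w → s₂.reg 10 ≤ w := by
      intro w i j hw h1 h2 h3 h4 h5 hc
      by_cases h6 : i < s.idx 14 ∨ j < s.idx 15
      · exact hbest w i j hw h1 h2 h3 h4 h6 hc
      · obtain rfl : j = s.idx 15 := by omega
        exact hcol w i hw (by omega) hc
    refine Halts.seq (Halts.block (Halts.cond (fun hb' => Halts.skip ?_)
      fun hb' => Halts.instr ?_)) <;> simp [Test.Holds, Instr.eval, i₂, h.one, h.finish] at hb'
    · refine ⟨50 * (b - s.idx 14) + 50 * (b - (s.idx 15 + 1)),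
        ⟨?_, ?_, ?_, ?_, ?_, ?_, ?_, ?_, ?_, ?_, ?_, ?_, ?_, ?_, ?_, ?_, ?_⟩, ?_⟩
      · simp [Instr.eval, i₂, h.one]
      · simp [Instr.eval, i₂, h.zero]
      · simp [Instr.eval, i₂, h.finish]
      · simp [Instr.eval, g9]
      · simp [Instr.eval, r₂, h.arr0]
      · simp [Instr.eval, r₂, h.arr1]
      · simpa [Instr.eval, r₂] using h.suffix
      · simp [Instr.eval, i₂, h.one, hsucc]
      · simpa [Instr.eval, i₂] using h.le_i
      · simpa [Instr.eval, i₂] using h.i_le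
      · simp [Instr.eval, i₂, h.one]; omega
      · simp [Instr.eval, i₂, h.one]; omega
      · simp [Instr.eval, i₂, h.one]; omega
      · simpa [Instr.eval, i₂, g7, g8] using h.pref
      · simpa [Instr.eval] using hencl
      · simpa [Instr.eval, i₂, h.one] using hbest'
      · simp [Instr.eval, i₂, h.one]
      · simp only [List.length_cons, List.length_nil]
        omega
    -- The right end has left the array, so all pairs are discarded; setting the left end to `b`
    -- stops the loop.
    · refine ⟨50 * (b - (s.idx 15 + 1)),
        ⟨?_, ?_, ?_, ?_, ?_, ?_, ?_, ?_, ?_, ?_, ?_, ?_, ?_, ?_, ?_, ?_, ?_⟩, ?_⟩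
      · simp [Instr.eval, i₂, h.one]
      · simp [Instr.eval, i₂, h.zero]
      · simp [Instr.eval, i₂, h.finish]
      · simp [Instr.eval, g9]
      · simp [Instr.eval, r₂, h.arr0]
      · simp [Instr.eval, r₂, h.arr1]
      · simpa [Instr.eval, r₂] using h.suffix
      · simp [Instr.eval, i₂, h.one, hsucc]
      · simp [Instr.eval, i₂, h.finish, h.zero]; omega
      · simp [Instr.eval, i₂, h.finish, h.zero]
      · simp [Instr.eval, i₂, h.one]; omega
      · simp [Instr.eval, i₂, h.one]; omega
      · simp [Instr.eval, i₂, h.finish, h.zero]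
      · simp [Instr.eval, i₂, h.finish, h.zero]
      · simpa [Instr.eval] using hencl
      · simp [Instr.eval, i₂, h.one]
        intro w i j hw h1 h2 h3 h4 _ hc
        exact hbest' w i j hw h1 h2 h3 h4 (by omega) hc
      · simp [Instr.eval, i₂, h.one, h.finish, h.zero]
      · simp only [List.length_cons, List.length_nil]
        omega
  -- The `x`-extent is at least the `y`-extent: no later right end improves on the present cross
  -- with this left end.
  · rw [max_eq_left (not_lt.1 hb), g15'] at gle'
    have hbest' : ∀ w i j, 0 ≤ w → a ≤ i → i < b → a ≤ j → j < b →
        (i < s.idx 14 + 1 ∨ j < s.idx 15) → Coverable X Y a b i j w → s₂.reg 10 ≤ w := by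
      intro w i j hw h1 h2 h3 h4 h5 hc
      by_cases h6 : i < s.idx 14 ∨ j < s.idx 15
      · exact hbest w i j hw h1 h2 h3 h4 h6 hc
      · obtain rfl : i = s.idx 14 := by omega
        exact gle'.trans (hc.sub_le' hX h.le_j (by omega) h4)
    refine Halts.seq (Halts.block (Halts.seq (Halts.setMin (by simpa [Instr.eval] using g9)
      (Halts.seq (Halts.setMax (by simpa [Instr.eval] using g9) (Halts.block ?_))))))
    have hpl' : IsLeast (insert M (Y '' Set.Ico a (s.idx 14 + 1)))
        (min (s.reg 7) (Y (s.idx 14))) := by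
      rw [Ico_succ_eq_insert h.le_i, Set.image_insert_eq, Set.insert_comm, min_comm]
      exact hpl.insert _
    have hpg' : IsGreatest (insert m (Y '' Set.Ico a (s.idx 14 + 1)))
        (max (s.reg 8) (Y (s.idx 14))) := by
      rw [Ico_succ_eq_insert h.le_i, Set.image_insert_eq, Set.insert_comm, max_comm]
      exact hpg.insert _
    refine ⟨50 * (b - (s.idx 14 + 1)) + 50 * (b - s.idx 15),
      ⟨?_, ?_, ?_, ?_, ?_, ?_, ?_, ?_, ?_, ?_, ?_, ?_, ?_, ?_, ?_, ?_, ?_⟩, ?_⟩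
    · simp [Instr.eval, i₂, h.one]
    · simp [Instr.eval, i₂, h.zero]
    · simp [Instr.eval, i₂, h.finish]
    · simp [Instr.eval, g9]
    · simp [Instr.eval, r₂, h.arr0]
    · simp [Instr.eval, r₂, h.arr1]
    · simpa [Instr.eval, r₂] using h.suffix
    · simp [Instr.eval, i₂, hsucc]
    · simp [Instr.eval, i₂, h.one]; omega
    · simp [Instr.eval, i₂, h.one]; omega
    · simpa [Instr.eval, i₂] using h.le_j
    · simpa [Instr.eval, i₂] using h.j_le
    · intro _
      simpa [Instr.eval, i₂] using hj
    · intro _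
      simpa [Instr.eval, i₂, r₂, g7, g8, h.one, h.arr1] using And.intro hpl' hpg'
    · simpa [Instr.eval] using hencl
    · simpa [Instr.eval, i₂, h.one] using hbest'
    · simp [Instr.eval, i₂, h.one]
    · simp only [List.length_cons, List.length_nil]
      omega

lemma halts_sweep {B N : ℕ} (hN : 0 < N) {s : State} (h1 : s.idx 1 = 1) (h2 : s.idx 2 = 0)
    (h3 : s.idx 3 = N) (h6 : s.idx 6 = B) (h9 : s.reg 9 = 0)
    (hX : ∀ t u, B ≤ t → t ≤ u → u < B + N → s.rarr 0 t ≤ s.rarr 0 u)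
    (hmin : IsLeast (s.rarr 1 '' Set.Ico B (B + N)) (s.reg 4))
    (hmax : IsGreatest (s.rarr 1 '' Set.Ico B (B + N)) (s.reg 5))
    (hsuf : ∀ z, B ≤ z → z < B + N → IsLeast (s.rarr 1 '' Set.Ico z (B + N)) (s.rarr 2 z) ∧
      IsGreatest (s.rarr 1 '' Set.Ico z (B + N)) (s.rarr 3 z))
    (hend : s.rarr 2 (B + N) = s.reg 5) (hend' : s.rarr 3 (B + N) = s.reg 4) :
    Halts sweep s fun s' t =>
      IsMedianCross (segmentPoints (s.rarr 0) (s.rarr 1) B (B + N)) s'.output ∧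
        t ≤ 100 * N + 15 := by
  have hY : ∀ t, B ≤ t → t < B + N → s.reg 4 ≤ s.rarr 1 t ∧ s.rarr 1 t ≤ s.reg 5 :=
    fun t ht ht' => ⟨hmin.2 ⟨t, ⟨ht, ht'⟩, rfl⟩, hmax.2 ⟨t, ⟨ht, ht'⟩, rfl⟩⟩
  have hmM : s.reg 4 ≤ s.reg 5 := (hY B le_rfl (by omega)).1.trans (hY B le_rfl (by omega)).2
  refine Halts.seq (Halts.block (Halts.seq ?_))
  refine (Halts.loop (SweepInv (s.rarr 0) (s.rarr 1) B (B + N) (s.reg 4) (s.reg 5))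
    (fun k s' h hlt => halts_sweepStep hX hY hmM h
      (by simpa only [Test.Holds, h.finish] using hlt)) (100 * N) _ ?_).mono ?_
  · refine ⟨?_, ?_, ?_, ?_, ?_, ?_, ?_, ?_, ?_, ?_, ?_, ?_, ?_, ?_, ?_, ?_, ?_⟩
    · simp [Instr.eval, h1]
    · simp [Instr.eval, h2]
    · simp [Instr.eval, h6, h3]
    · simp [Instr.eval, h9]
    · simp [Instr.eval]
    · simp [Instr.eval]
    · intro z hz hz'
      simp only [List.foldl, Instr.eval]
      rcases hz'.lt_or_eq with hlt | rfl
      · obtain ⟨hl, hg⟩ := hsuf z hz.le hlt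
        have hl' := hl.insert (s.reg 5)
        have hg' := hg.insert (s.reg 4)
        obtain ⟨u, hu, hu'⟩ := hl.1
        obtain ⟨u₁, hu₁, hu₁'⟩ := hg.1
        rw [min_eq_right (hu' ▸ (hY u (by have := hu.1; omega) hu.2).2)] at hl'
        rw [max_eq_right (hu₁' ▸ (hY u₁ (by have := hu₁.1; omega) hu₁.2).1)] at hg'
        exact ⟨hl', hg'⟩
      · rw [hend, hend', Set.Ico_self, Set.image_empty, insert_empty_eq]
        rw [insert_empty_eq]
        exact ⟨isLeast_singleton, isGreatest_singleton⟩
    · simp [Instr.eval, h1]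
    · simp [Instr.eval, h6, h2]
    · simp [Instr.eval, h6, h2]
    · simp [Instr.eval, h6, h2]
    · simp [Instr.eval, h6, h2]
    · simp [Instr.eval, h6, h2, hN]
    · intro _
      simp [Instr.eval, RealOp.eval, h6, h2, h9]
    -- The initial candidate covers everything by its horizontal strip, of width `M - m`.
    · rintro _ ⟨t, ht, ht', rfl⟩
      rw [mem_stripCross]
      right
      obtain ⟨ha, hb⟩ := hY t ht ht'
      simp [Instr.eval, RealOp.eval]
      rw [abs_le]
      constructor <;> linarith
    · intro w i j _ hi _ hj _ hij
      simp [Instr.eval, h6, h2] at hij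
      omega
    · simp [Instr.eval, h6, h2]
      omega
  · rintro s' t ⟨k, h, hb, ht⟩
    simp only [Test.Holds, h.finish] at hb
    refine Halts.block ⟨⟨s'.reg 10, ?_, ?_, ?_⟩, ?_⟩
    · have := mem_stripCross.1 (h.encl ⟨B, le_rfl, by omega, rfl⟩)
      rcases this with h | h <;> linarith [(abs_nonneg _).trans h]
    -- Registers `11` and `12` hold twice the centre; the halving happens only in the final block.
    · convert h.encl using 2
      simp [Instr.eval, RealOp.eval, State.output, div_eq_mul_inv]
    · intro c' w' hw' hc'
      -- The left end has reached `b`, so every pair of positions counts as discarded and `best`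
      -- applies to any competitor.
      obtain ⟨i, j, hi, hi', hj, hj', hc⟩ := exists_coverable (by omega) hw' hc'
      exact h.best w' i j hw' hi hi' hj hj' (Or.inl (by omega)) hc
    · simp only [List.length_cons, List.length_nil]
      omega

/-! ### The complete program -/

/-- Computes median highways. -/
def medianCross : Program :=
  .seq computeSize (.seq padPoints (.seq mergeSort (.seq suffixExtrema sweep)))

lemma halts_medianCross (v : ℝ) {n : ℕ} (hn : 2 ≤ n) (p : Fin n → ℝ × ℝ) :
    Halts medianCross (input v p) fun s t => IsMedianCross (Set.range p) s.output ∧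
      ∃ K, 2 ^ K < 2 * n ∧ t ≤ 300 * n + 100 * n * K := by
  have hrange : segmentPoints ((input v p).rarr 0) ((input v p).rarr 1) 0 n = Set.range p := by
    ext z
    constructor
    · rintro ⟨t, -, ht, rfl⟩
      exact ⟨⟨t, ht⟩, by simp [input, ht]⟩
    · rintro ⟨i, rfl⟩
      exact ⟨i, Nat.zero_le _, i.2, by simp [input]⟩
  refine Halts.seq ((halts_computeSize hn (by simp [input]) (by simp [input])).mono ?_)
  rintro s₁ t₁ ⟨e0, e1, e2, er, ⟨K, eK⟩, hle, hlt, ht₁⟩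
  obtain ⟨N, hN⟩ : ∃ N, s₁.idx 3 = N := ⟨_, rfl⟩
  rw [hN] at eK hle hlt
  refine Halts.seq ((halts_padPoints (by omega) hle e0 e1 e2 hN).mono ?_)
  rintro s₂ t₂ ⟨f1, f2, f3, hS₂, ht₂⟩
  rw [er, hrange] at hS₂
  refine Halts.seq ((halts_mergeSort eK f1 f2 f3).mono ?_)
  rintro s₃ t₃ ⟨g1, g2, g3, hsort, hS₃, ht₃⟩
  rw [hS₂] at hS₃
  refine Halts.seq ((halts_suffixExtrema (by omega) g1 g2 g3 rfl).mono ?_)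
  rintro s₄ t₄ ⟨k1, k2, k3, k6, k9, q0, q1, hmin, hmax, hsuf, hend, hend', ht₄⟩
  refine (halts_sweep (s := s₄) (by omega) k1 k2 k3 k6 k9 ?_ ?_ ?_ ?_ hend hend').mono ?_
  · intro t u h1 h2 h3
    rw [q0]
    exact hsort.le h1 h2 h3
  · rwa [q1]
  · rwa [q1]
  · rwa [q1]
  · rintro s₅ t₅ ⟨hmed, ht₅⟩
    rw [q0, q1, hS₃] at hmed
    refine ⟨hmed, K, by omega, ?_⟩
    have hK : K * (40 * N + 12) ≤ 100 * n * K := by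
      rw [mul_comm]
      exact Nat.mul_le_mul_right K (by omega)
    omega

end RealRAM

/-! ### Final estimates: running time and approximation factor -/

/-- Taking logarithms, `K * log 2 ≤ log 2 + log n ≤ 2 * log n`, and `log 2 > 1 / 2`. The second
bound absorbs the linear terms of the running time. -/
lemma natCast_le_four_mul_log {n K : ℕ} (hn : 2 ≤ n) (hK : 2 ^ K < 2 * n) :
    (K : ℝ) ≤ 4 * Real.log n ∧ 1 ≤ 2 * Real.log n := by
  have hn' : (2 : ℝ) ≤ n := by exact_mod_cast hn
  have h2 : Real.log 2 ≤ Real.log n := Real.log_le_log (by norm_num) hn'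
  have hlog2 := Real.log_two_gt_d9
  have hpow : (2 : ℝ) ^ K ≤ 2 * n := by exact_mod_cast hK.le
  have h := Real.log_le_log (by positivity) hpow
  rw [Real.log_pow, Real.log_mul (by norm_num) (by positivity)] at h
  have hK0 : (0 : ℝ) ≤ K := Nat.cast_nonneg K
  constructor
  · nlinarith
  · linarith

/-- Both median highways and arbitrary highways are good enough for a suitable range of speeds. -/
lemma IsMedianCross.travelDiam_le_one_add_sqrt_two {S : Set (ℝ × ℝ)} (hf : S.Finite)
    (hS : S.Nonempty) {v : ℝ} (hv : 1 < v) {c : ℝ × ℝ} (hc : IsMedianCross S c) (τ : ℝ × ℝ) :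
    travelDiam v S c ≤ (1 + √2) * travelDiam v S τ := by
  have h0 := travelDiam_nonneg hf hS hv.le τ
  have hsq := Real.mul_self_sqrt (show (0 : ℝ) ≤ 2 by norm_num)
  have hs0 := Real.sqrt_nonneg 2
  -- At `v = 1 + √2` both factors agree, because `1 / (1 + √2) = √2 - 1`.
  rcases le_total v (1 + √2) with hle | hle
  · refine le_trans ?_ (mul_le_mul_of_nonneg_right hle h0)
    exact _root_.travelDiam_le hS fun p hp q hq =>
      (travelTime_le_l1Dist hv.le c p q).trans (l1Dist_le_mul_travelDiam hf hv.le τ hp hq)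
  · refine (hc.travelDiam_le hf hS hv.le τ).trans (mul_le_mul_of_nonneg_right ?_ h0)
    have : 1 / v ≤ √2 - 1 := by
      rw [div_le_iff₀ (by linarith)]
      have h1 : 1 < √2 := Real.lt_sqrt_of_sq_lt (by norm_num)
      nlinarith
    linarith

theorem mainTheorem8 :
    -- median highways and optimal crosses exist; the median highways are a factor-`(2 + 1 / v)`
    -- approximation, building no highway is a factor-`v` approximation
    (∀ v : ℝ, 1 < v → ∀ S : Set (ℝ × ℝ), S.Finite → S.Nonempty →
      (∃ c, IsMedianCross S c) ∧ (∃ τ, IsOptimalCross v S τ) ∧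
      ∀ τ, IsOptimalCross v S τ →
        (∀ c, IsMedianCross S c → travelDiam v S c ≤ (2 + 1 / v) * travelDiam v S τ) ∧
        l1Diam S ≤ v * travelDiam v S τ) ∧
    -- lower bound examples
    (∀ v : ℝ, √3 ≤ v → ∃ S : Set (ℝ × ℝ), S.Finite ∧ 3 ≤ S.ncard ∧
      ∀ c τ, IsMedianCross S c → IsOptimalCross v S τ →
        (2 - 1 / (v + 2)) * travelDiam v S τ ≤ travelDiam v S c) ∧
    -- a `(1 + √2)`-approximate cross can be computed in `O(n log n)` time
    (∃ (P : RealRAM.Program) (C : ℝ), ∀ v : ℝ, 1 < v → ∀ n : ℕ, 2 ≤ n → ∀ p : Fin n → ℝ × ℝ,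
      ∃ (s : RealRAM.State) (t : ℕ), RealRAM.Exec P (RealRAM.input v p) s t ∧
        (t : ℝ) ≤ C * (n * Real.log n) ∧
        ∀ τ, IsOptimalCross v (Set.range p) τ →
          travelDiam v (Set.range p) s.output ≤ (1 + √2) * travelDiam v (Set.range p) τ) := by
  refine ⟨fun v hv S hf hS => ⟨exists_isMedianCross hf hS, exists_isOptimalCross hf hS hv.le,
    fun τ _ => ⟨fun c hc => hc.travelDiam_le hf hS hv.le τ,
      l1Diam_le_mul_travelDiam hf hS hv.le τ⟩⟩, fun v hv => exists_bad_median_cross hv,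
    RealRAM.medianCross, 1000, fun v hv n hn p => ?_⟩
  obtain ⟨s, t, hexec, hmed, K, hK, ht⟩ := RealRAM.halts_medianCross v hn p
  have hne : (Set.range p).Nonempty := ⟨_, ⟨0, by omega⟩, rfl⟩
  refine ⟨s, t, hexec, ?_, fun τ _ =>
    hmed.travelDiam_le_one_add_sqrt_two (Set.finite_range p) hne hv τ⟩
  obtain ⟨h1, h2⟩ := natCast_le_four_mul_log hn hK
  have hn0 : (0 : ℝ) ≤ n := Nat.cast_nonneg n
  have ht' : (t : ℝ) ≤ 300 * n + 100 * n * K := by exact_mod_cast ht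
  have h3 := mul_le_mul_of_nonneg_left h1 hn0
  have h4 := mul_le_mul_of_nonneg_left h2 hn0
  linarith
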